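/- A stack $d^m$ is a pair of positive integers $(d,m)$ with degree $d$ and multiplicity $m$. A stack partition $\tau$ is a finite multiset of stacks $(d_1^{m_1},\dots,d_s^{m_s})$ (listed in weakly decreasing order). Write $\tau\Vdash n$ if $\sum_i d_im_i=n$, put $\operatorname{sgn}(\tau)=(-1)^{m_1+\cdots+m_s}$, and let $\tau|_k$ be the integer partition formed by the multiplicities of the stacks of degree $k$ in $\tau$. Let $\mathbf x_{k*}=(x_{k,1},x_{k,2},\dots)$ for $k\ge1$ be indeterminates, and work in the algebra of polysymmetric functions over $\mathbb Q$, i.e. the formal series of bounded degree (where $x_{k,j}$ has degree $k$) that are symmetric in $\mathbf x_{k*}$ for each $k$. Let $s_\sigma^{\otimes}=\prod_{k\ge1}s_{\sigma|_k}(\mathbf x_{k*})$, where $s_\mu$ is the Schur function. Let $M_\alpha$ be the sum of all distinct monomials $x_{d_1,j_1}^{m_1}\cdots x_{d_s,j_s}^{m_s}$ in pairwise distinct variables, for $\alpha=(d_1^{m_1},\dots,d_s^{m_s})$; let $H_d^+=\sum_{\alpha\Vdash d}\operatorname{sgn}(\alpha)M_\alpha$, and let $H^+_{d^r}$ be obtained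 from $H^+_d$ by replacing every variable $x_{i,j}$ by $x_{i,j}^r$. Draw partitions as Young diagrams with rows of weakly decreasing length from top to bottom. An $r$-ribbon is a skew shape with $r$ cells that can be traversed, from its southwest end to its northeast end (its head), by unit steps to the right or up; its sign is $(-1)^{h-1}$, where $h$ is the number of rows it occupies. A skew shape $\nu/\mu$ is an $r^n$-polyribbon ($n\ge0$) if $\nu$ can be obtained from $\mu$ by adding $n$ successive $r$-ribbons, each step giving a partition, such that the columns of the heads of these ribbons strictly increase. These ribbons are then uniquely determined, and $\operatorname{sgn}_r(\nu/\mu)$ denotes the product of their signs. **Theorem.** Let $\sigma$ be a stack partition and $d^r$ a stack. Then $$s_\sigma^{\otimes}\,H^+_{d^r}=\sum_\tau \operatorname{sgn}_r^{-\otimes}(\tau/\sigma)\,s_\tau^{\otimes},$$ where $\tau$ runs over the (finitely many) stack partitions for which there is an integer partition $\lambda\vdash d$ such that, for every $k\ge1$, $\tau|_k$ is obtained by adding an $r^{m_k(\lambda)}$-polyribbon to $\sigma|_k$. Here $m_k(\lambda)$ is the number of parts of $\lambda$ equal to $k$; the partition $\lambda$ is determined by $\sigma,\tau,r$, and $$\operatorname{sgn}_r^{-\otimes}(\tau/\sigma)=(-1)^{\ell(\lambda)}\prod_{k\ge1}\operatorname{sgn}_r\bigl((\tau|_k)/(\sigma|_k)\bigr),$$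 where $\ell(\lambda)$ is the number of parts of $\lambda$. -/

import Mathlib

open Finset

/-- A stack partition: a finite multiset of stacks `d ^ m`, where the stack `(d, m)` has degree `d`
and multiplicity `m`. (Weakly decreasing sequences for a total order correspond bijectively to
finite multisets.) -/
abbrev StackPartition : Type := Multiset (ℕ+ × ℕ+)

namespace StackPartition

/-- `|α| = ∑ dᵢ mᵢ`; so `α ⊩ n` means `α.size = n`. -/
def size (α : StackPartition) : ℕ := (α.map fun s => (s.1 : ℕ) * (s.2 : ℕ)).sum

/-- The sum of all multiplicities. -/
def area (α : StackPartition) : ℕ := (α.map fun s => (s.2 : ℕ)).sum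

/-- `sgn α = (-1) ^ area α`. -/
def sign (α : StackPartition) : ℤ := (-1) ^ α.area

/-- The multiset of the multiplicities of the stacks of degree `k`. -/
def multiplicities (α : StackPartition) (k : ℕ+) : Multiset ℕ :=
  (α.filter fun s => s.1 = k).map fun s => (s.2 : ℕ)

/-- The partition `α|ₖ`, as the Young diagram whose row lengths are the multiplicities of the
stacks of degree `k`. -/
def restrict (α : StackPartition) (k : ℕ+) : YoungDiagram :=
  YoungDiagram.ofRowLens ((α.multiplicities k).sort (· ≥ ·))
    (Multiset.pairwise_sort (α.multiplicities k) (· ≥ ·)).sortedGE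

theorem mul_le_size {α : StackPartition} {s : ℕ+ × ℕ+} (hs : s ∈ α) :
    (s.1 : ℕ) * (s.2 : ℕ) ≤ α.size :=
  Multiset.single_le_sum (fun _ _ => Nat.zero_le _) _ (Multiset.mem_map_of_mem _ hs)

theorem card_le_size (α : StackPartition) : Multiset.card α ≤ α.size := by
  induction α using Multiset.induction with
  | empty => simp
  | cons s α ih =>
    have h : 1 ≤ (s.1 : ℕ) * (s.2 : ℕ) := Nat.mul_pos s.1.pos s.2.pos
    simp only [size, Multiset.map_cons, Multiset.sum_cons, Multiset.card_cons] at ih ⊢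
    omega

/-- There are finitely many stack partitions of `n`. -/
theorem finite_size (n : ℕ) : {α : StackPartition | α.size = n}.Finite := by
  let N : ℕ+ := n.succPNat
  refine (Set.finite_Iic (n • (Finset.Icc (1 : ℕ+) N ×ˢ Finset.Icc (1 : ℕ+) N).val)).subset ?_
  intro α hα
  have hα : StackPartition.size α = n := hα
  rw [Set.mem_Iic, Multiset.le_iff_count]
  intro s
  by_cases hs : s ∈ α
  · have h1 := mul_le_size hs
    have hc := (Multiset.count_le_card s α).trans (card_le_size α)
    have p1 := s.1.pos
    have p2 := s.2.pos
    have ha : s.1 ≤ N := by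
      rw [← PNat.coe_le_coe, Nat.succPNat_coe, Nat.succ_eq_add_one]
      nlinarith
    have hb : s.2 ≤ N := by
      rw [← PNat.coe_le_coe, Nat.succPNat_coe, Nat.succ_eq_add_one]
      nlinarith
    have hm : s ∈ Finset.Icc (1 : ℕ+) N ×ˢ Finset.Icc (1 : ℕ+) N := by
      simp [Finset.mem_product, ha, hb]
    rw [Multiset.count_nsmul, Multiset.count_eq_one_of_mem (Finset.nodup _) hm]
    omega
  · simp [Multiset.count_eq_zero_of_notMem hs]

/-- The finite set of all stack partitions of `n`. -/
noncomputable def ofSize (n : ℕ) : Finset StackPartition := (finite_size n).toFinset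

end StackPartition

/-- The formal power series over `ℚ` in the variables `x (i, j)`, `i ≥ 1`, where `x (i, j)` is the
`j`-th variable of degree `i`. The polysymmetric functions are the series of bounded degree that
are symmetric in `x (i, *)` for every fixed `i`. -/
abbrev PolySeries : Type := MvPowerSeries (ℕ+ × ℕ) ℚ

namespace PolySeries

/-- The Schur function `s_μ` in the variables `x (k, *)`: the sum over all semistandard Young
tableaux `T` of shape `μ` of the monomials `∏ x (k, T c)`, where `c` runs over the cells of `μ`. -/
noncomputable def schur (k : ℕ+) (μ : YoungDiagram) : PolySeries := fun m =>
  (Nat.card {T : SemistandardYoungTableau μ //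
    ∑ c ∈ μ.cells, Finsupp.single (k, T c.1 c.2) 1 = m} : ℚ)

/-- The pure tensor `s_σ^⊗ = ∏ₖ s_{σ|ₖ}(x (k, *))`. Almost all factors are `s_∅ = 1`. -/
noncomputable def schurTensor (σ : StackPartition) : PolySeries :=
  ∏ᶠ k : ℕ+, schur k (σ.restrict k)

/-- The monomial polysymmetric function `M_α`: the sum of the distinct monomials
`x (d₁, j₁) ^ m₁ ⋯ x (dₛ, jₛ) ^ mₛ` in which the variables are pairwise distinct, where
`α = (d₁ ^ m₁, …, dₛ ^ mₛ)`. -/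
noncomputable def monomialPoly (α : StackPartition) : PolySeries := fun m =>
  if m.support.val.map (fun v => ((v.1 : ℕ), m v)) = α.map (fun s => ((s.1 : ℕ), (s.2 : ℕ)))
  then 1 else 0

/-- `H⁺_d`, the sum of `sgn(α) M_α` over all stack partitions `α` of `d`. -/
noncomputable def signedH (d : ℕ) : PolySeries :=
  ∑ α ∈ StackPartition.ofSize d, (α.sign : ℚ) • monomialPoly α

/-- `H⁺_{d ^ r}`: every variable of `H⁺_d` is replaced by its `r`-th power. -/
noncomputable def signedHStack (d r : ℕ+) : PolySeries :=
  MvPowerSeries.expand (r : ℕ) r.ne_zero (signedH d)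

end PolySeries

/-- The skew shape `ν / μ` is an `r`-ribbon: it has `r` cells, and these can be traversed, from its
southwest end to its northeast end, by unit steps to the right or up. -/
def IsRibbon (r : ℕ) (μ ν : YoungDiagram) : Prop :=
  μ ≤ ν ∧ #(ν.cells \ μ.cells) = r ∧
    ∃ p : ℕ → ℕ × ℕ, ν.cells \ μ.cells = (range r).image p ∧
      ∀ i, i + 1 < r →
        p (i + 1) = ((p i).1, (p i).2 + 1) ∨ p i = ((p (i + 1)).1 + 1, (p (i + 1)).2)

/-- The sign `(-1) ^ (h - 1)` of a ribbon `ν / μ` that occupies `h` rows. -/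
def ribbonSign (μ ν : YoungDiagram) : ℤ :=
  (-1) ^ (#((ν.cells \ μ.cells).image Prod.fst) - 1)

/-- The column of the northeast end (the head) of a ribbon `ν / μ`, i.e. its last column. -/
def headColumn (μ ν : YoungDiagram) : ℕ := (ν.cells \ μ.cells).sup Prod.snd

/-- A way to obtain `ν` from `μ` by adding `n` successive `r`-ribbons whose heads lie in columns
that strictly increase from left to right. -/
structure RibbonChain (r n : ℕ) (μ ν : YoungDiagram) where
  shape : Fin (n + 1) → YoungDiagram
  shape_zero : shape 0 = μ
  shape_last : shape (Fin.last n) = ν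
  isRibbon : ∀ i : Fin n, IsRibbon r (shape i.castSucc) (shape i.succ)
  headColumn_lt : ∀ i j : Fin n, i < j →
    headColumn (shape i.castSucc) (shape i.succ) < headColumn (shape j.castSucc) (shape j.succ)

/-- The product of the signs of the ribbons. -/
def RibbonChain.sign {r n : ℕ} {μ ν : YoungDiagram} (C : RibbonChain r n μ ν) : ℤ :=
  ∏ i : Fin n, ribbonSign (C.shape i.castSucc) (C.shape i.succ)

/-- `ν / μ` is an `r ^ n`-polyribbon. -/
def IsPolyribbon (r n : ℕ) (μ ν : YoungDiagram) : Prop := Nonempty (RibbonChain r n μ ν)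

open Classical in
/-- `sgn_r(ν / μ)`: the product of the signs of the `r`-ribbons that make up the polyribbon `ν / μ`.
(The chain of ribbons is determined by `r`, `μ` and `ν`; the value is `0` for other shapes.) -/
noncomputable def polyribbonSign (r : ℕ) (μ ν : YoungDiagram) : ℤ :=
  if h : ∃ n, IsPolyribbon r n μ ν then (Classical.choice h.choose_spec).sign else 0

theorem IsPolyribbon.card_eq {r n : ℕ} {μ ν : YoungDiagram} (h : IsPolyribbon r n μ ν) :
    ν.card = μ.card + n * r := by
  obtain ⟨C⟩ := h
  have key : ∀ i (hi : i < n + 1), (C.shape ⟨i, hi⟩).card = μ.card + i * r := by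
    intro i
    induction i with
    | zero =>
      intro hi
      have := C.shape_zero
      rw [show (⟨0, hi⟩ : Fin (n + 1)) = 0 from rfl, this]
      simp
    | succ i ih =>
      intro hi
      obtain ⟨h1, h2, -⟩ := C.isRibbon ⟨i, by omega⟩
      have h3 := ih (by omega)
      have h4 := card_sdiff_add_card_eq_card (YoungDiagram.cells_subset_iff.2 h1)
      simp only [Fin.castSucc_mk, Fin.succ_mk] at h2 h4
      rw [h2] at h4
      simp only [YoungDiagram.card] at h3 ⊢
      rw [← h4, h3]
      ring
  have := key n (Nat.lt_succ_self n)
  rw [← this]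
  exact congrArg YoungDiagram.card C.shape_last.symm

/-- `τ` is obtained from `σ` by adding, for every `k ≥ 1`, an `r ^ m_k(lam)`-polyribbon to `σ|ₖ`,
where `m_k(lam)` is the number of parts of `lam` that are equal to `k`. -/
def IsAssociated (r : ℕ+) {d : ℕ} (lam : Nat.Partition d) (σ τ : StackPartition) : Prop :=
  ∀ k : ℕ+, IsPolyribbon r (lam.parts.count (k : ℕ)) (σ.restrict k) (τ.restrict k)

/-- The partition associated with `τ / σ` is unique. -/
theorem IsAssociated.unique {r : ℕ+} {d : ℕ} {lam lam' : Nat.Partition d} {σ τ : StackPartition}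
    (h : IsAssociated r lam σ τ) (h' : IsAssociated r lam' σ τ) : lam = lam' := by
  ext k
  rcases Nat.eq_zero_or_pos k with rfl | hk
  · rw [Multiset.count_eq_zero_of_notMem fun h0 => (lam.parts_pos h0).ne' rfl,
      Multiset.count_eq_zero_of_notMem fun h0 => (lam'.parts_pos h0).ne' rfl]
  · have h1 := (h ⟨k, hk⟩).card_eq
    have h2 := (h' ⟨k, hk⟩).card_eq
    rw [h1] at h2
    exact Nat.eq_of_mul_eq_mul_right r.pos (Nat.add_left_cancel h2)

/-- The stack partitions obtained from `σ` by adding polyribbons as prescribed by some `lam ⊢ d`. -/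
def pieriSet (σ : StackPartition) (d r : ℕ+) : Set StackPartition :=
  {τ | ∃ lam : Nat.Partition d, IsAssociated r lam σ τ}

open Classical in
/-- `sgn_r^{-⊗}(τ / σ) = (-1) ^ ℓ(lam) * ∏ₖ sgn_r(τ|ₖ / σ|ₖ)`, where `lam ⊢ d` is the partition
associated with `τ / σ` (and `0` if there is none). Almost all factors are `1`. -/
noncomputable def pieriSign (d r : ℕ+) (σ τ : StackPartition) : ℤ :=
  if h : ∃ lam : Nat.Partition d, IsAssociated r lam σ τ then
    (-1) ^ Multiset.card h.choose.parts *
      ∏ᶠ k : ℕ+, polyribbonSign r (σ.restrict k) (τ.restrict k)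
  else 0

/-!
The theorem reduces to one alphabet. A monomial of `H⁺_{d ^ r}` has the sign `(-1) ^ ℓ(lam)`, where
`lam ⊢ d` is the partition formed by the degrees of its variables `x (k, j) ^ r`. Hence
`H⁺_{d ^ r}` is the sum over `lam ⊢ d` of `(-1) ^ ℓ(lam) ∏ₖ hₙ(x (k, *) ^ r)` with `n = m_k(lam)`
(`signedHStack_eq_sum`). A stack partition is a family of Young diagrams of which almost all are
empty (`restrict_injective`, `exists_restrict_eq`), so it suffices to multiply out, for every `k`,
the plethystic Pieri rule `s_μ(x) hₙ(x ^ r) = ∑ sgn_r(ν / μ) s_ν(x)`, the sum over the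
`r ^ n`-polyribbons `ν / μ` (`schur_mul_completePower`).

For this rule it is enough to consider `N` variables with `N` large. There `s_μ` times the
Vandermonde product is the alternant `det (x i ^ b)`, where `b` runs over the `N` beads of `μ`
(`det_beadSeq`, by comparing branching rules). Multiplying the alternant by `∑ₙ hₙ(x ^ r) tⁿ`
replaces each column `x ^ b` by `x ^ b + t x ^ (b + r) + t² x ^ (b + 2r) + ⋯`. This linear
map on columns is obtained by applying, for the positions `p` in increasing order, the elementary
maps `x ^ (p - r) ↦ x ^ (p - r) + t x ^ p`, so the result is a signed sum over chains of bead moves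
`p - r → p` with increasing targets `p` (`coeff_prod_mul_wedge`). No cancellation is left, as
the two ends of such a chain determine it (`BeadChain.unique`).

Moving a bead by `r` to an empty position amounts to adding an `r`-ribbon, its sign is the parity of
the number of beads that are jumped over, and the targets of successive moves increase exactly if
the columns of the heads do (`isPolyribbon_iff`, `polyribbonSign_eq`).
-/

namespace PolyPieri

/-! ### Bead sets of Young diagrams -/

/-- The bead set of `μ` with `N` beads: row `i < N` contributes a bead at position
`μ.rowLen i + (N - 1 - i)`. It determines `μ` among the diagrams with at most `N` rows; the latter
condition is written `μ.rowLen N = 0`. -/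
def beads (N : ℕ) (μ : YoungDiagram) : Finset ℕ :=
  (range N).image fun i => μ.rowLen i + (N - 1 - i)

/-- The number of beads at positions `≥ x`. For `B = beads N μ` it counts, up to a shift that
does not depend on `μ`, the cells of `μ` on the diagonal `j - i = x - N`; see `mem_iff_lt_tail`. -/
def tail (B : Finset ℕ) (x : ℕ) : ℕ := #(B.filter (x ≤ ·))

theorem tail_succ (B : Finset ℕ) (x : ℕ) :
    tail B x = tail B (x + 1) + if x ∈ B then 1 else 0 := by
  unfold tail
  have h : B.filter (x ≤ ·) = B.filter (x + 1 ≤ ·) ∪ B.filter (x = ·) := by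
    ext y; simp only [mem_filter, mem_union]; grind
  rw [h, card_union_of_disjoint, Finset.filter_eq]
  · split_ifs <;> simp
  · rw [disjoint_left]; intro y; simp only [mem_filter]; grind

theorem tail_anti (B : Finset ℕ) : Antitone (tail B) :=
  antitone_nat_of_succ_le fun x => by rw [tail_succ B x]; omega

theorem add_tail_mono (B : Finset ℕ) : Monotone fun x => x + tail B x :=
  monotone_nat_of_le_succ fun x => by
    have := tail_succ B x
    split_ifs at this <;> grind

theorem tail_zero (B : Finset ℕ) : tail B 0 = #B := by simp [tail]

theorem tail_le_card (B : Finset ℕ) (x : ℕ) : tail B x ≤ #B := card_filter_le _ _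

theorem card_le_add_tail (B : Finset ℕ) (x : ℕ) : #B ≤ x + tail B x := by
  have := add_tail_mono B (Nat.zero_le x)
  simpa [tail_zero] using this

theorem eq_of_tail_eq {B C : Finset ℕ} (h : ∀ x, tail B x = tail C x) : B = C := by
  ext x
  have h1 := tail_succ B x
  have h2 := tail_succ C x
  rw [h x, h (x + 1)] at h1
  grind

theorem bead_lt_bead (μ : YoungDiagram) {N i j : ℕ} (hij : i < j) (hj : j < N) :
    μ.rowLen j + (N - 1 - j) < μ.rowLen i + (N - 1 - i) := by
  have := μ.rowLen_anti i j hij.le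
  omega

theorem bead_injOn (N : ℕ) (μ : YoungDiagram) :
    Set.InjOn (fun i => μ.rowLen i + (N - 1 - i)) (range N : Set ℕ) := by
  intro i hi j hj h
  simp only [coe_range, Set.mem_Iio] at hi hj
  rcases lt_trichotomy i j with hl | hl | hl
  · have := bead_lt_bead μ hl hj
    simp only at h; omega
  · exact hl
  · have := bead_lt_bead μ hl hi
    simp only at h; omega

theorem card_beads (N : ℕ) (μ : YoungDiagram) : #(beads N μ) = N := by
  rw [beads, card_image_of_injOn (bead_injOn N μ), card_range]

/-- The beads at positions `≥ x` are those of an initial segment of rows. -/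
theorem lt_tail_beads_iff {N i x : ℕ} (μ : YoungDiagram) (hi : i < N) :
    i < tail (beads N μ) x ↔ x ≤ μ.rowLen i + (N - 1 - i) := by
  have h0 : tail (beads N μ) x = #((range N).filter fun i => x ≤ μ.rowLen i + (N - 1 - i)) := by
    rw [tail, beads, filter_image, card_image_of_injOn]
    exact (bead_injOn N μ).mono (coe_subset.2 (filter_subset _ _))
  rw [h0]
  constructor
  · intro h
    by_contra hx
    have : (range N).filter (fun i => x ≤ μ.rowLen i + (N - 1 - i)) ⊆ range i := by
      intro j hj
      simp only [mem_filter, mem_range] at hj ⊢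
      by_contra hij
      rcases eq_or_lt_of_le (not_lt.1 hij) with rfl | hij
      · exact hx hj.2
      · have := bead_lt_bead μ hij hj.1
        omega
    have := card_le_card this
    rw [card_range] at this
    omega
  · intro h
    have : range (i + 1) ⊆ (range N).filter (fun i => x ≤ μ.rowLen i + (N - 1 - i)) := by
      intro j hj
      simp only [mem_filter, mem_range] at hj ⊢
      refine ⟨by omega, ?_⟩
      rcases eq_or_lt_of_le (Nat.lt_succ_iff.1 hj) with rfl | hij
      · exact h
      · have := bead_lt_bead μ hij hi
        omega
    have := card_le_card this
    rw [card_range] at this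
    omega

/-- A diagonal of a Young diagram is filled from its upper left end. The difference `j + N - i` is
truncated only for `i > N`, where both sides are false. -/
theorem mem_iff_lt_tail {N i j : ℕ} {μ : YoungDiagram} (hμ : μ.rowLen N = 0) :
    (i, j) ∈ μ ↔ i < tail (beads N μ) (j + N - i) := by
  rcases lt_or_ge i N with hi | hi
  · rw [lt_tail_beads_iff μ hi, YoungDiagram.mem_iff_lt_rowLen]
    omega
  · have h1 := μ.rowLen_anti N i hi
    have h2 := tail_le_card (beads N μ) (j + N - i)
    rw [card_beads] at h2
    rw [YoungDiagram.mem_iff_lt_rowLen]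
    omega

theorem beads_injective {N : ℕ} {μ ν : YoungDiagram} (hμ : μ.rowLen N = 0) (hν : ν.rowLen N = 0)
    (h : beads N μ = beads N ν) : μ = ν := by
  apply YoungDiagram.ext
  ext ⟨i, j⟩
  rw [YoungDiagram.mem_cells, YoungDiagram.mem_cells, mem_iff_lt_tail hμ, mem_iff_lt_tail hν, h]

/-- Every finite set is the bead set of a Young diagram. -/
theorem exists_beads_eq (B : Finset ℕ) :
    ∃ μ : YoungDiagram, μ.rowLen #B = 0 ∧ beads #B μ = B := by
  set N := #B with hN
  have hlow : ∀ {i j i' j' : ℕ}, i' ≤ i → j' ≤ j → i < tail B (j + N - i) →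
      i' < tail B (j' + N - i') := by
    intro i j i' j' hi hj h
    have h1 := tail_le_card B (j + N - i)
    have h2 : j' + N - i' ≤ j + N - i' := by omega
    have h3 := tail_anti B h2
    have h4 := add_tail_mono B (show j + N - i ≤ j + N - i' by omega)
    simp only at h4
    omega
  obtain ⟨M, hM⟩ : ∃ M, ∀ b ∈ B, b < M :=
    ⟨B.sup id + 1, fun b hb => Nat.lt_succ_of_le (le_sup (f := id) hb)⟩
  -- the cells `(i, j)` with `i < tail B (j + N - i)`, in a box that contains all of them
  let μ : YoungDiagram :=
    { cells := (range N ×ˢ range M).filter fun c => c.1 < tail B (c.2 + N - c.1)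
      isLowerSet := by
        rintro ⟨i, j⟩ ⟨i', j'⟩ ⟨hi, hj⟩ h
        simp only [coe_filter, mem_product, mem_range, Set.mem_ofPred_eq] at h hi hj ⊢
        exact ⟨⟨by omega, by omega⟩, hlow hi hj h.2⟩ }
  have hmem : ∀ i j, (i, j) ∈ μ ↔ i < tail B (j + N - i) := by
    intro i j
    rw [← YoungDiagram.mem_cells]
    simp only [μ, mem_filter, mem_product, mem_range, and_iff_right_iff_imp]
    intro h
    have h1 := tail_le_card B (j + N - i)
    refine ⟨by omega, ?_⟩
    have h2 : 0 < tail B (j + N - i) := by omega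
    rw [tail, card_pos] at h2
    obtain ⟨b, hb⟩ := h2
    rw [mem_filter] at hb
    have := hM b hb.1
    omega
  have hrow : μ.rowLen N = 0 := by
    by_contra h
    have h1 := (YoungDiagram.mem_iff_lt_rowLen (μ := μ) (i := N) (j := 0)).2 (by omega)
    rw [hmem] at h1
    have := tail_le_card B (0 + N - N)
    omega
  refine ⟨μ, hrow, eq_of_tail_eq fun x => ?_⟩
  -- for `N ≤ x + i` a cell on the diagonal `x` decides; otherwise both sides hold
  have key : ∀ i, i < tail (beads N μ) x ↔ i < tail B x := by
    intro i
    rcases lt_or_ge i N with hi | hi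
    · rcases le_or_gt N (x + i) with hx | hx
      · have h1 := mem_iff_lt_tail (i := i) (j := x + i - N) hrow
        rw [hmem] at h1
        have e : x + i - N + N - i = x := by omega
        rw [e] at h1
        exact h1.symm
      · have h1 := card_le_add_tail B x
        have h2 := card_le_add_tail (beads N μ) x
        rw [card_beads] at h2
        constructor <;> intro <;> omega
    · have h1 := tail_le_card B x
      have h2 := tail_le_card (beads N μ) x
      rw [card_beads] at h2
      constructor <;> intro <;> omega
  have h1 := key (tail B x)
  have h2 := key (tail (beads N μ) x)
  omega

theorem beads_le_iff {N : ℕ} {μ ν : YoungDiagram} (hμ : μ.rowLen N = 0) (hν : ν.rowLen N = 0) :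
    μ ≤ ν ↔ ∀ x, tail (beads N μ) x ≤ tail (beads N ν) x := by
  constructor
  · intro h x
    by_contra hx
    push Not at hx
    have h1 := card_le_add_tail (beads N ν) x
    have h2 := tail_le_card (beads N μ) x
    rw [card_beads] at h1 h2
    set i := tail (beads N ν) x with hi
    have e : x + i - N + N - i = x := by omega
    have h3 : (i, x + i - N) ∈ μ := by rw [mem_iff_lt_tail hμ, e]; exact hx
    have h4 := h h3
    change (i, x + i - N) ∈ ν at h4
    rw [mem_iff_lt_tail hν, e] at h4
    omega
  · rintro h ⟨i, j⟩ hc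
    change (i, j) ∈ μ at hc
    rw [mem_iff_lt_tail hμ] at hc
    rw [mem_iff_lt_tail hν]
    exact hc.trans_le (h _)

/-- A bead move adds one cell on each of the `r` diagonals that the bead passes. -/
theorem tail_move {B : Finset ℕ} {b r : ℕ} (hb : b ∈ B) (hbr : b + r ∉ B) (x : ℕ) :
    tail (insert (b + r) (B.erase b)) x =
      tail B x + if b < x ∧ x ≤ b + r then 1 else 0 := by
  unfold tail
  rw [filter_insert, filter_erase]
  have h1 : b + r ∉ ((B.filter (x ≤ ·)).erase b) := by simp [hbr]
  have h2 : ∀ h : x ≤ b, #((B.filter (x ≤ ·)).erase b) + 1 = #(B.filter (x ≤ ·)) := fun h =>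
    card_erase_add_one (by simp [hb, h])
  have h3 : ¬ x ≤ b → (B.filter (x ≤ ·)).erase b = B.filter (x ≤ ·) := fun h =>
    erase_eq_of_notMem (by simp [h])
  by_cases hx : x ≤ b
  · rw [if_pos (by omega), card_insert_of_notMem h1, h2 hx, if_neg (by omega)]
    rfl
  · by_cases hx' : x ≤ b + r
    · rw [if_pos hx', card_insert_of_notMem h1, h3 hx, if_pos (by omega)]
    · rw [if_neg hx', h3 hx, if_neg (by omega)]
      rfl

theorem card_move {B : Finset ℕ} {b r : ℕ} (hb : b ∈ B) (hbr : b + r ∉ B) :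
    #(insert (b + r) (B.erase b)) = #B := by
  have := tail_move hb hbr 0
  simpa [tail_zero] using this

/-! ### Ribbons as bead moves -/

theorem mem_skew_iff {N i j : ℕ} {μ ν : YoungDiagram} (hμ : μ.rowLen N = 0)
    (hν : ν.rowLen N = 0) : (i, j) ∈ ν.cells \ μ.cells ↔
      tail (beads N μ) (j + N - i) ≤ i ∧ i < tail (beads N ν) (j + N - i) := by
  rw [mem_sdiff, YoungDiagram.mem_cells, YoungDiagram.mem_cells, mem_iff_lt_tail hμ,
    mem_iff_lt_tail hν, not_lt, and_comm]

theorem cell_mem_skew {N x i : ℕ} {μ ν : YoungDiagram} (hμ : μ.rowLen N = 0)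
    (hν : ν.rowLen N = 0) (h1 : tail (beads N μ) x ≤ i) (h2 : i < tail (beads N ν) x) :
    (i, x + i - N) ∈ ν.cells \ μ.cells ∧ x + i - N + N - i = x := by
  have h3 := card_le_add_tail (beads N μ) x
  rw [card_beads] at h3
  have e : x + i - N + N - i = x := by omega
  refine ⟨?_, e⟩
  rw [mem_skew_iff hμ hν, e]
  exact ⟨h1, h2⟩

/-- The cell on the diagonal `x` of a ribbon that is added to a diagram with bead set `B`. -/
def ribbonCell (N : ℕ) (B : Finset ℕ) (x : ℕ) : ℕ × ℕ := (tail B x, x + tail B x - N)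

section Move

variable {N b r : ℕ} {μ ν : YoungDiagram}

theorem skew_eq_image (hμ : μ.rowLen N = 0) (hν : ν.rowLen N = 0) (hb : b ∈ beads N μ)
    (hbr : b + r ∉ beads N μ) (h : beads N ν = insert (b + r) ((beads N μ).erase b)) :
    ν.cells \ μ.cells = (Icc (b + 1) (b + r)).image (ribbonCell N (beads N μ)) := by
  have ht := tail_move hb hbr
  rw [← h] at ht
  ext ⟨i, j⟩
  rw [mem_skew_iff hμ hν, ht, mem_image]
  constructor
  · rintro ⟨h1, h2⟩
    refine ⟨j + N - i, ?_⟩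
    have h3 := tail_le_card (beads N ν) (j + N - i)
    rw [card_beads, ht] at h3
    split_ifs at h2 with hx
    · have : tail (beads N μ) (j + N - i) = i := by omega
      refine ⟨by rw [mem_Icc]; omega, ?_⟩
      rw [if_pos hx] at h3
      simp only [ribbonCell, this, Prod.mk.injEq, true_and]
      omega
    · omega
  · rintro ⟨x, hx, hc⟩
    rw [mem_Icc] at hx
    simp only [ribbonCell, Prod.mk.injEq] at hc
    have h3 := card_le_add_tail (beads N μ) x
    have h4 := tail_le_card (beads N μ) x
    rw [card_beads] at h3 h4
    have e : j + N - i = x := by omega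
    rw [e, if_pos (by omega)]
    omega

theorem ribbonCell_injective (N : ℕ) (B : Finset ℕ) (hB : #B = N) :
    Function.Injective (ribbonCell N B) := by
  intro x y h
  simp only [ribbonCell, Prod.mk.injEq] at h
  have h3 := card_le_add_tail B x
  have h4 := card_le_add_tail B y
  omega

theorem isRibbon_of_move (hr : 0 < r) (hμ : μ.rowLen N = 0) (hν : ν.rowLen N = 0)
    (hb : b ∈ beads N μ) (hbr : b + r ∉ beads N μ)
    (h : beads N ν = insert (b + r) ((beads N μ).erase b)) : IsRibbon r μ ν := by
  have hs := skew_eq_image hμ hν hb hbr h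
  refine ⟨?_, ?_, fun i => ribbonCell N (beads N μ) (b + 1 + i), ?_, ?_⟩
  · rw [beads_le_iff hμ hν, h]
    intro x
    rw [tail_move hb hbr]
    omega
  · rw [hs, card_image_of_injective _ (ribbonCell_injective N _ (card_beads N μ)), Nat.card_Icc]
    omega
  · rw [hs]
    ext c
    simp only [mem_image, mem_Icc, mem_range]
    constructor
    · rintro ⟨x, hx, rfl⟩
      exact ⟨x - (b + 1), by omega, by rw [show b + 1 + (x - (b + 1)) = x by omega]⟩
    · rintro ⟨i, hi, rfl⟩
      exact ⟨b + 1 + i, by omega, rfl⟩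
  · intro i _
    have h1 := tail_succ (beads N μ) (b + 1 + i)
    have h3 := card_le_add_tail (beads N μ) (b + 1 + i)
    have h4 := card_le_add_tail (beads N μ) (b + 1 + (i + 1))
    rw [card_beads] at h3 h4
    simp only [ribbonCell, Prod.mk.injEq]
    rw [← add_assoc] at *
    split_ifs at h1 <;> omega

/-- The cells of a ribbon lie on `r` consecutive diagonals, one on each, so the numbers of cells on
the diagonals change as under a bead move. -/
theorem exists_move_of_isRibbon (hr : 0 < r) (hμ : μ.rowLen N = 0) (hν : ν.rowLen N = 0)
    (h : IsRibbon r μ ν) : ∃ b ∈ beads N μ, b + r ∉ beads N μ ∧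
      beads N ν = insert (b + r) ((beads N μ).erase b) := by
  obtain ⟨hle, -, p, hp, hstep⟩ := h
  have hmem : ∀ i < r, p i ∈ ν.cells \ μ.cells := fun i hi => by
    rw [hp]; exact mem_image_of_mem _ (mem_range.2 hi)
  have hrow : ∀ i < r, (p i).1 < N := fun i hi => by
    have h1 := ((mem_skew_iff hμ hν).1 (hmem i hi)).2
    have h2 := tail_le_card (beads N ν) ((p i).2 + N - (p i).1)
    rw [card_beads] at h2
    omega
  set x₀ := (p 0).2 + N - (p 0).1 with hx₀
  -- each step to the right or up leads to the next diagonal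
  have hdiag : ∀ i < r, (p i).2 + N - (p i).1 = x₀ + i := by
    intro i
    induction i with
    | zero => intro _; rfl
    | succ i ih =>
      intro hi
      have h1 := ih (by omega)
      have h2 := hrow i (by omega)
      rcases hstep i hi with h3 | h3
      · rw [h3]; simp only; omega
      · have h4 : (p i).1 = (p (i + 1)).1 + 1 := by rw [h3]
        have h5 : (p i).2 = (p (i + 1)).2 := by rw [h3]
        omega
  have hle' := (beads_le_iff hμ hν).1 hle
  -- so the skew shape has exactly one cell on each of the `r` diagonals from `x₀` on
  have htail : ∀ x, tail (beads N ν) x =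
      tail (beads N μ) x + if x₀ ≤ x ∧ x < x₀ + r then 1 else 0 := by
    intro x
    have h0 := hle' x
    have hcell : ∀ i, tail (beads N μ) x ≤ i → i < tail (beads N ν) x →
        ∃ k < r, x₀ + k = x ∧ (p k).1 = i := by
      intro i h1 h2
      obtain ⟨h3, h4⟩ := cell_mem_skew hμ hν h1 h2
      rw [hp, mem_image] at h3
      obtain ⟨k, hk, hk'⟩ := h3
      rw [mem_range] at hk
      refine ⟨k, hk, ?_, by rw [hk']⟩
      rw [← hdiag k hk, hk', h4]
    split_ifs with hx
    · have h1 := (mem_skew_iff hμ hν).1 (hmem (x - x₀) (by omega))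
      rw [hdiag _ (by omega), show x₀ + (x - x₀) = x by omega] at h1
      by_contra hne
      obtain ⟨k, -, h3, h4⟩ := hcell (tail (beads N μ) x) le_rfl (by omega)
      obtain ⟨k', -, h3', h4'⟩ := hcell (tail (beads N μ) x + 1) (by omega) (by omega)
      have : k = k' := by omega
      subst this
      omega
    · by_contra hne
      obtain ⟨k, hk, h3, -⟩ := hcell (tail (beads N μ) x) le_rfl (by omega)
      omega
  -- the diagonal `0` has no cells, as `tail _ 0` counts all `N` beads
  have hpos : 0 < x₀ := by
    by_contra hx
    have h1 := htail 0
    rw [tail_zero, tail_zero, card_beads, card_beads, if_pos (by omega)] at h1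
    omega
  clear_value x₀
  obtain ⟨b, rfl⟩ : ∃ b, x₀ = b + 1 := ⟨x₀ - 1, by omega⟩
  have hb : b ∈ beads N μ := by
    have h1 := tail_succ (beads N μ) b
    have h2 := tail_succ (beads N ν) b
    have h3 := htail b
    have h4 := htail (b + 1)
    rw [if_neg (by omega)] at h3
    rw [if_pos (by omega)] at h4
    by_contra hb
    rw [if_neg hb] at h1
    split_ifs at h2 <;> omega
  have hbr : b + r ∉ beads N μ := by
    have h1 := tail_succ (beads N μ) (b + r)
    have h2 := tail_succ (beads N ν) (b + r)
    have h3 := htail (b + r)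
    have h4 := htail (b + r + 1)
    rw [if_pos (by omega)] at h3
    rw [if_neg (by omega)] at h4
    intro hb
    rw [if_pos hb] at h1
    split_ifs at h2 <;> omega
  refine ⟨b, hb, hbr, eq_of_tail_eq fun x => ?_⟩
  rw [htail, tail_move hb hbr]
  congr 1
  exact if_congr (by omega) rfl rfl

theorem image_tail_Icc (B : Finset ℕ) {x y : ℕ} (hxy : x ≤ y) :
    (Icc x y).image (tail B) = Icc (tail B y) (tail B x) := by
  induction y, hxy using Nat.le_induction with
  | base => simp
  | succ y hxy ih =>
    have h1 := tail_succ B y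
    have h2 := tail_anti B hxy
    have h3 : Icc x (y + 1) = insert (y + 1) (Icc x y) := by
      ext z; simp only [mem_insert, mem_Icc]; omega
    rw [h3, image_insert, ih]
    ext z
    rw [mem_insert, mem_Icc, mem_Icc]
    split_ifs at h1 <;> omega

theorem tail_add_card_between (B : Finset ℕ) {x y : ℕ} (h : x ≤ y) :
    tail B x = tail B y + #(B.filter fun c => x ≤ c ∧ c < y) := by
  unfold tail
  rw [← card_union_of_disjoint]
  · congr 1
    ext z; simp only [mem_filter, mem_union]; grind
  · rw [disjoint_left]; intro y; simp only [mem_filter]; grind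

/-- The ribbon occupies one row more than the number of beads that are jumped over. -/
theorem ribbonSign_of_move (hr : 0 < r) (hμ : μ.rowLen N = 0) (hν : ν.rowLen N = 0)
    (hb : b ∈ beads N μ) (hbr : b + r ∉ beads N μ)
    (h : beads N ν = insert (b + r) ((beads N μ).erase b)) :
    ribbonSign μ ν = (-1) ^ #((beads N μ).filter fun c => b < c ∧ c < b + r) := by
  rw [ribbonSign, skew_eq_image hμ hν hb hbr h, image_image]
  change (-1) ^ (#((Icc (b + 1) (b + r)).image (tail (beads N μ))) - 1) = _
  rw [image_tail_Icc _ (by omega), Nat.card_Icc,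
    tail_add_card_between (beads N μ) (show b + 1 ≤ b + r by omega)]
  congr 1
  simp only [Nat.add_one_le_iff]
  omega

/-- The head is the cell on the last diagonal `b + r`, since `x + tail B x` is weakly increasing. -/
theorem headColumn_of_move (hr : 0 < r) (hμ : μ.rowLen N = 0) (hν : ν.rowLen N = 0)
    (hb : b ∈ beads N μ) (hbr : b + r ∉ beads N μ)
    (h : beads N ν = insert (b + r) ((beads N μ).erase b)) :
    headColumn μ ν + N = b + r + tail (beads N μ) (b + r) := by
  have h0 := card_le_add_tail (beads N μ) (b + r)
  rw [card_beads] at h0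
  have : headColumn μ ν = b + r + tail (beads N μ) (b + r) - N := by
    rw [headColumn, skew_eq_image hμ hν hb hbr h, sup_image]
    apply le_antisymm
    · refine Finset.sup_le fun x hx => ?_
      have := add_tail_mono (beads N μ) (mem_Icc.1 hx).2
      simp only [Function.comp, ribbonCell] at this ⊢
      omega
    · exact le_sup (f := Prod.snd ∘ ribbonCell N (beads N μ))
        (mem_Icc.2 ⟨show b + 1 ≤ b + r by omega, le_rfl⟩)
  omega

end Move

/-! ### Chains of bead moves and chains of ribbons -/

/-- `BeadChain r p n B B' ε`: the bead set `B'` arises from `B` by moving a bead `n` times, each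
time by `r` to an empty position, where the positions moved to strictly increase and are `≥ p`.
The sign `ε` is the parity of the total number of beads that are jumped over. -/
inductive BeadChain (r : ℕ) : ℕ → ℕ → Finset ℕ → Finset ℕ → ℤ → Prop
  | nil (p : ℕ) (B : Finset ℕ) : BeadChain r p 0 B B 1
  | cons {p n b : ℕ} {B B' : Finset ℕ} {ε : ℤ} (hb : b ∈ B) (hbr : b + r ∉ B) (hp : p ≤ b + r)
      (h : BeadChain r (b + r + 1) n (insert (b + r) (B.erase b)) B' ε) :
      BeadChain r p (n + 1) B B' ((-1) ^ #(B.filter fun c => b < c ∧ c < b + r) * ε)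

namespace BeadChain

variable {r p n : ℕ} {B B' : Finset ℕ} {ε : ℤ}

theorem mono {q : ℕ} (h : BeadChain r p n B B' ε) (hq : q ≤ p) : BeadChain r q n B B' ε := by
  cases h with
  | nil => exact nil _ _
  | cons hb hbr hp h => exact cons hb hbr (hq.trans hp) h

/-- Positions below `p - r` are neither filled nor vacated. -/
theorem mem_iff (h : BeadChain r p n B B' ε) {y : ℕ} (hy : y + r < p) : y ∈ B' ↔ y ∈ B := by
  induction h with
  | nil => rfl
  | @cons p n b B B' ε hb hbr hp h ih =>
    rw [ih (by omega), mem_insert, mem_erase]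
    constructor
    · rintro (h | h)
      · omega
      · exact h.2
    · intro h
      exact Or.inr ⟨by omega, h⟩

theorem exists_le_mem (h : BeadChain r p (n + 1) B B' ε) : ∃ q ∈ B', p ≤ q := by
  induction n generalizing p B B' ε with
  | zero =>
    cases h with
    | @cons _ _ b _ _ _ hb hbr hp h =>
      cases h
      exact ⟨b + r, mem_insert_self _ _, hp⟩
  | succ n ih =>
    cases h with
    | cons hb hbr hp h =>
      obtain ⟨q, hq, hq'⟩ := ih h
      exact ⟨q, hq, by omega⟩

/-- A bead that moves in one chain stays in place in a chain all of whose targets are larger, so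
that two such chains end differently. -/
theorem not_of_move {p n n' b : ℕ} {B B' : Finset ℕ} {ε ε' : ℤ} (hr : 0 < r) (hb : b ∈ B)
    (hlt : b + r < p) (h : BeadChain r p n B B' ε) :
    ¬ BeadChain r (b + r + 1) n' (insert (b + r) (B.erase b)) B' ε' := by
  intro h'
  have h1 := (h.mem_iff hlt).2 hb
  rw [h'.mem_iff (by omega), mem_insert, mem_erase] at h1
  rcases h1 with h1 | h1
  · omega
  · exact h1.1 rfl

/-- The first move is determined by the two ends of the chain, and so is the whole chain. -/
theorem unique {n' : ℕ} {ε' : ℤ} (hr : 0 < r) (h : BeadChain r p n B B' ε)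
    (h' : BeadChain r p n' B B' ε') : n = n' ∧ ε = ε' := by
  induction h generalizing n' ε' with
  | nil p B =>
    cases h' with
    | nil => exact ⟨rfl, rfl⟩
    | @cons _ n b _ _ ε' hb hbr hp h' =>
      exact absurd h' (not_of_move hr hb (Nat.lt_succ_self _) (nil _ _))
  | @cons p n b B B' ε hb hbr hp h ih =>
    have hcons := cons hb hbr le_rfl h
    cases h' with
    | nil => exact absurd h (not_of_move hr hb (Nat.lt_succ_self _) (nil _ _))
    | @cons _ n' b' _ _ ε' hb' hbr' hp' h' =>
      rcases lt_trichotomy b b' with hlt | rfl | hlt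
      · exact absurd h (not_of_move hr hb (by omega) (cons hb' hbr' le_rfl h'))
      · obtain ⟨rfl, rfl⟩ := ih h'
        exact ⟨rfl, rfl⟩
      · exact absurd h' (not_of_move hr hb' (by omega) hcons)

end BeadChain

theorem rowLen_eq_zero_of_le {N : ℕ} {μ ν : YoungDiagram} (h : μ ≤ ν) (hν : ν.rowLen N = 0) :
    μ.rowLen N = 0 := by
  by_contra h0
  have h1 := (YoungDiagram.mem_iff_lt_rowLen (μ := μ) (i := N) (j := 0)).2 (by omega)
  have h2 : (N, 0) ∈ ν := h h1
  rw [YoungDiagram.mem_iff_lt_rowLen] at h2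
  omega

end PolyPieri

namespace RibbonChain
open PolyPieri

variable {r n : ℕ} {μ ν : YoungDiagram}

/-- The chain without its first ribbon. -/
def dropFirst (C : RibbonChain r (n + 1) μ ν) : RibbonChain r n (C.shape 1) ν where
  shape i := C.shape i.succ
  shape_zero := rfl
  shape_last := C.shape_last
  isRibbon i := C.isRibbon i.succ
  headColumn_lt i j h := C.headColumn_lt i.succ j.succ (Fin.succ_lt_succ_iff.2 h)

theorem isRibbon_first (C : RibbonChain r (n + 1) μ ν) : IsRibbon r μ (C.shape 1) := by
  have := C.isRibbon 0
  rwa [Fin.castSucc_zero, C.shape_zero] at this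

theorem sign_eq_mul (C : RibbonChain r (n + 1) μ ν) :
    C.sign = ribbonSign μ (C.shape 1) * C.dropFirst.sign := by
  rw [sign, Fin.prod_univ_succ, Fin.castSucc_zero, C.shape_zero]
  rfl

theorem le (C : RibbonChain r n μ ν) : μ ≤ ν := by
  induction n generalizing μ with
  | zero => exact (C.shape_zero.symm.trans C.shape_last).le
  | succ n ih => exact C.isRibbon_first.1.trans (ih C.dropFirst)

/-- The chain that starts with a given ribbon. -/
def addFirst {κ : YoungDiagram} (C : RibbonChain r n μ ν) (h : IsRibbon r κ μ)
    (hlt : ∀ hn : 0 < n, headColumn κ μ < headColumn μ (C.shape (Fin.succ ⟨0, hn⟩))) :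
    RibbonChain r (n + 1) κ ν where
  shape := Fin.cons κ C.shape
  shape_zero := rfl
  shape_last := C.shape_last
  isRibbon i := by
    induction i using Fin.cases with
    | zero => simpa [C.shape_zero] using h
    | succ i => exact C.isRibbon i
  headColumn_lt i j hij := by
    have h0 : ∀ j : Fin n,
        headColumn κ μ < headColumn (C.shape j.castSucc) (C.shape j.succ) := by
      intro j
      have hn : 0 < n := j.pos
      have h1 : headColumn κ μ <
          headColumn (C.shape (Fin.castSucc ⟨0, hn⟩)) (C.shape (Fin.succ ⟨0, hn⟩)) :=
        (hlt hn).trans_eq (congrArg (headColumn · _) C.shape_zero.symm)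
      rcases Nat.eq_zero_or_pos (j : ℕ) with hj | hj
      · rwa [show j = ⟨0, hn⟩ from Fin.ext hj]
      · exact h1.trans (C.headColumn_lt ⟨0, hn⟩ j hj)
    induction j using Fin.cases with
    | zero => exact absurd hij (Fin.not_lt_zero i)
    | succ j =>
      induction i using Fin.cases with
      | zero => simpa [C.shape_zero] using h0 j
      | succ i => exact C.headColumn_lt i j (Fin.succ_lt_succ_iff.1 hij)

theorem sign_addFirst {κ : YoungDiagram} (C : RibbonChain r n μ ν) (h : IsRibbon r κ μ)
    (hlt : ∀ hn : 0 < n, headColumn κ μ < headColumn μ (C.shape (Fin.succ ⟨0, hn⟩))) :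
    (C.addFirst h hlt).sign = ribbonSign κ μ * C.sign := by
  rw [sign, Fin.prod_univ_succ]
  congr 1
  simp [addFirst, C.shape_zero]

/-- Increasing head columns force increasing targets: if a bead has moved to `q` and the next move
had a target below `q`, then the head of the second ribbon would be weakly to the left of the head
of the first. The hypothesis `hp` says that the first target is `≥ p`. -/
theorem beadChain {N : ℕ} (hr : 0 < r) (hν : ν.rowLen N = 0) (C : RibbonChain r n μ ν) (p : ℕ)
    (hp : ∀ hn : 0 < n, ∀ b ∈ beads N μ, b + r ∉ beads N μ →
      beads N (C.shape (Fin.succ ⟨0, hn⟩)) = insert (b + r) ((beads N μ).erase b) → p ≤ b + r) :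
    BeadChain r p n (beads N μ) (beads N ν) C.sign := by
  induction n generalizing μ p with
  | zero =>
    have : μ = ν := C.shape_zero.symm.trans C.shape_last
    subst this
    simpa [sign] using BeadChain.nil p (beads N μ)
  | succ n ih =>
    have hμ₁ := rowLen_eq_zero_of_le C.dropFirst.le hν
    have hμ := rowLen_eq_zero_of_le C.isRibbon_first.1 hμ₁
    obtain ⟨b, hb, hbr, h⟩ := exists_move_of_isRibbon hr hμ hμ₁ C.isRibbon_first
    rw [sign_eq_mul, ribbonSign_of_move hr hμ hμ₁ hb hbr h]
    refine BeadChain.cons hb hbr (hp n.succ_pos b hb hbr h) ?_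
    rw [← h]
    refine ih C.dropFirst _ fun hn b' hb' hbr' h' => ?_
    have hμ₂ : (C.dropFirst.shape (Fin.succ ⟨0, hn⟩)).rowLen N = 0 := by
      obtain ⟨m, rfl⟩ : ∃ m, n = m + 1 := ⟨n - 1, by omega⟩
      exact rowLen_eq_zero_of_le C.dropFirst.dropFirst.le hν
    have h1 := headColumn_of_move hr hμ hμ₁ hb hbr h
    have h2 := headColumn_of_move hr hμ₁ hμ₂ hb' hbr' h'
    have h3 : headColumn μ (C.shape 1) <
        headColumn (C.shape 1) (C.dropFirst.shape (Fin.succ ⟨0, hn⟩)) := by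
      have := C.headColumn_lt 0 (Fin.succ ⟨0, hn⟩) (Fin.succ_pos _)
      rw [Fin.castSucc_zero, C.shape_zero] at this
      exact this
    -- `x + tail B x` is weakly increasing in `x`, and the empty position `b' + r` contributes `1`
    by_contra hlt
    have hne : b' + r ≠ b + r := fun e => hbr' (by rw [e, h]; exact mem_insert_self _ _)
    have h4 := tail_succ (beads N (C.shape 1)) (b' + r)
    have h5 := add_tail_mono (beads N (C.shape 1)) (show b' + r + 1 ≤ b + r by omega)
    have h6 := tail_move hb hbr (b + r)
    rw [← h, if_pos (by omega)] at h6
    rw [if_neg hbr'] at h4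
    simp only at h5
    omega

end RibbonChain

namespace PolyPieri

/-- Increasing targets give increasing head columns. The last clause is the induction hypothesis
that compares a new first head with the next one. -/
theorem BeadChain.exists_ribbonChain {N r p n : ℕ} {B B' : Finset ℕ} {ε : ℤ} (hr : 0 < r)
    (h : BeadChain r p n B B' ε) : ∀ μ ν : YoungDiagram, μ.rowLen N = 0 → ν.rowLen N = 0 →
      beads N μ = B → beads N ν = B' → ∃ C : RibbonChain r n μ ν, C.sign = ε ∧
        ∀ hn : 0 < n, p + tail B p ≤ headColumn μ (C.shape (Fin.succ ⟨0, hn⟩)) + N := by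
  induction h with
  | nil p B =>
    intro μ ν hμ hν h1 h2
    have : μ = ν := beads_injective hμ hν (h1.trans h2.symm)
    subst this
    exact ⟨⟨fun _ => μ, rfl, rfl, fun i => i.elim0, fun i => i.elim0⟩, by simp [RibbonChain.sign],
      fun hn => absurd hn (lt_irrefl _)⟩
  | @cons p n b B B' ε hb hbr hp h ih =>
    intro μ ν hμ hν h1 h2
    obtain ⟨κ, hκ, hκ'⟩ := exists_beads_eq (insert (b + r) (B.erase b))
    rw [show #(insert (b + r) (B.erase b)) = N by rw [card_move hb hbr, ← h1, card_beads]] at hκ hκ'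
    obtain ⟨C, hC, hC'⟩ := ih κ ν hκ hν hκ' h2
    subst h1
    have hhead := headColumn_of_move hr hμ hκ hb hbr hκ'
    have hlt : ∀ hn : 0 < n, headColumn μ κ < headColumn κ (C.shape (Fin.succ ⟨0, hn⟩)) := by
      intro hn
      have h3 := hC' hn
      rw [tail_move hb hbr, if_neg (by omega)] at h3
      have h4 := tail_succ (beads N μ) (b + r)
      rw [if_neg hbr] at h4
      omega
    refine ⟨C.addFirst (isRibbon_of_move hr hμ hκ hb hbr hκ') hlt, ?_, ?_⟩
    · rw [RibbonChain.sign_addFirst, hC, ribbonSign_of_move hr hμ hκ hb hbr hκ']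
    · intro hn
      have h5 : headColumn μ ((C.addFirst (isRibbon_of_move hr hμ hκ hb hbr hκ') hlt).shape
          (Fin.succ ⟨0, hn⟩)) = headColumn μ κ := by
        congr 1
        exact C.shape_zero
      rw [h5, hhead]
      exact add_tail_mono _ hp

theorem isPolyribbon_iff {N r n : ℕ} {μ ν : YoungDiagram} (hr : 0 < r) (hμ : μ.rowLen N = 0)
    (hν : ν.rowLen N = 0) :
    IsPolyribbon r n μ ν ↔ ∃ ε, BeadChain r 0 n (beads N μ) (beads N ν) ε := by
  constructor
  · rintro ⟨C⟩
    exact ⟨_, C.beadChain hr hν 0 fun _ _ _ _ _ => Nat.zero_le _⟩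
  · rintro ⟨ε, h⟩
    obtain ⟨C, -⟩ := h.exists_ribbonChain hr μ ν hμ hν rfl rfl
    exact ⟨C⟩

theorem polyribbonSign_eq {N r n : ℕ} {μ ν : YoungDiagram} {ε : ℤ} (hr : 0 < r)
    (hμ : μ.rowLen N = 0) (hν : ν.rowLen N = 0)
    (h : BeadChain r 0 n (beads N μ) (beads N ν) ε) : polyribbonSign r μ ν = ε := by
  have h' : ∃ n, IsPolyribbon r n μ ν := ⟨n, (isPolyribbon_iff hr hμ hν).2 ⟨ε, h⟩⟩
  rw [polyribbonSign, dif_pos h']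
  exact ((Classical.choice h'.choose_spec).beadChain hr hν 0
    fun _ _ _ _ _ => Nat.zero_le _).unique hr h |>.2

/-! ### Minors of a matrix with columns indexed by `ℕ` -/

section Wedge

variable {R : Type*} [CommRing R]

/-- The minor, on the columns in `B` taken in increasing order, of the matrix with the columns
`f b`; the value is `0` unless `B` has `N` elements. -/
noncomputable def wedge {N : ℕ} (f : ℕ → Fin N → R) (B : Finset ℕ) : R :=
  if h : #B = N then Matrix.det (Matrix.of fun i j => f (B.orderEmbOfFin h j) i) else 0

theorem wedge_eq_det {N : ℕ} (f : ℕ → Fin N → R) {B : Finset ℕ} (e : Fin N → ℕ)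
    (he : StrictMono e) (hB : ∀ j, e j ∈ B) (h : #B = N) :
    wedge f B = Matrix.det (Matrix.of fun i j => f (e j) i) := by
  rw [wedge, dif_pos h, ← orderEmbOfFin_unique h hB he]

theorem wedge_congr {N : ℕ} {f f' : ℕ → Fin N → R} {B : Finset ℕ} (h : ∀ b ∈ B, f b = f' b) :
    wedge f B = wedge f' B := by
  unfold wedge
  split_ifs with hB
  · congr 1
    ext i j
    simp only [Matrix.of_apply]
    rw [h _ (orderEmbOfFin_mem B hB j)]
  · rfl

theorem map_wedge {S : Type*} [CommRing S] (φ : R →+* S) {N : ℕ} (f : ℕ → Fin N → R)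
    (B : Finset ℕ) : φ (wedge f B) = wedge (fun b i => φ (f b i)) B := by
  unfold wedge
  split_ifs
  · rw [RingHom.map_det]
    rfl
  · exact map_zero φ

/-- The determinant with first column `v` followed by the columns of `f` in `C`, as its Laplace
expansion along the first column. -/
noncomputable def wedgeCons {N : ℕ} (v : Fin (N + 1) → R) (f : ℕ → Fin (N + 1) → R)
    (C : Finset ℕ) : R :=
  ∑ i : Fin (N + 1), (-1) ^ (i : ℕ) * v i * wedge (fun c j => f c (i.succAbove j)) C

theorem wedgeCons_add_mul {N : ℕ} (v w : Fin (N + 1) → R) (t : R) (f : ℕ → Fin (N + 1) → R)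
    (C : Finset ℕ) :
    wedgeCons (fun i => v i + t * w i) f C = wedgeCons v f C + t * wedgeCons w f C := by
  simp only [wedgeCons, mul_sum, ← sum_add_distrib]
  exact sum_congr rfl fun i _ => by ring

theorem wedgeCons_congr {N : ℕ} (v : Fin (N + 1) → R) {f f' : ℕ → Fin (N + 1) → R}
    {C : Finset ℕ} (h : ∀ c ∈ C, f c = f' c) : wedgeCons v f C = wedgeCons v f' C :=
  sum_congr rfl fun i _ => by
    rw [wedge_congr (f' := fun c j => f' c (i.succAbove j)) fun c hc => by rw [h c hc]]

theorem wedgeCons_self {N : ℕ} (f : ℕ → Fin (N + 1) → R) {C : Finset ℕ} {c : ℕ} (hc : c ∈ C)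
    (hC : #C = N) : wedgeCons (f c) f C = 0 := by
  obtain ⟨j, hj⟩ : ∃ j, C.orderEmbOfFin hC j = c := by
    have : c ∈ Set.range (C.orderEmbOfFin hC) := by rw [range_orderEmbOfFin]; exact hc
    exact this
  let M : Matrix (Fin (N + 1)) (Fin (N + 1)) R :=
    Matrix.of fun i k => f ((Fin.cons c (C.orderEmbOfFin hC) : Fin (N + 1) → ℕ) k) i
  have h0 : M.det = 0 :=
    Matrix.det_zero_of_column_eq (i := 0) (j := j.succ) (Fin.succ_ne_zero j).symm
      fun i => by simp [M, hj]
  rw [Matrix.det_succ_column_zero] at h0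
  rw [← h0, wedgeCons]
  refine sum_congr rfl fun i _ => ?_
  rw [wedge, dif_pos hC]
  rfl

/-- Sorting the column `b` to the front. -/
theorem wedge_insert {N : ℕ} (f : ℕ → Fin (N + 1) → R) {C : Finset ℕ} {b : ℕ} (hb : b ∉ C)
    (hC : #C = N) :
    wedge f (insert b C) = (-1) ^ #(C.filter (· < b)) * wedgeCons (f b) f C := by
  have h : #(insert b C) = N + 1 := by rw [card_insert_of_notMem hb, hC]
  set e := (insert b C).orderEmbOfFin h with he
  obtain ⟨k, hk⟩ : ∃ k, e k = b := by
    have : b ∈ Set.range e := by rw [range_orderEmbOfFin]; exact mem_insert_self b C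
    exact this
  have hmem : ∀ j, e j ∈ insert b C := fun j => orderEmbOfFin_mem _ h j
  have hmemC : ∀ j, e (k.succAbove j) ∈ C := by
    intro j
    rcases mem_insert.1 (hmem (k.succAbove j)) with h1 | h1
    · exact absurd (e.injective (h1.trans hk.symm)) (Fin.succAbove_ne k j)
    · exact h1
  -- the column `b` has as many columns on its left as there are smaller elements of `C`
  have hcard : #(C.filter (· < b)) = k := by
    have : C.filter (· < b) = (Iio k).map e.toEmbedding := by
      ext c
      simp only [mem_filter, mem_map, mem_Iio, RelEmbedding.coe_toEmbedding]
      constructor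
      · rintro ⟨h1, h2⟩
        have : c ∈ Set.range e := by
          rw [range_orderEmbOfFin]; exact mem_insert_of_mem h1
        obtain ⟨j, rfl⟩ := this
        rw [← hk, e.lt_iff_lt] at h2
        exact ⟨j, h2, rfl⟩
      · rintro ⟨j, h1, rfl⟩
        rw [← e.lt_iff_lt, hk] at h1
        exact ⟨(mem_insert.1 (hmem j)).resolve_left h1.ne, h1⟩
    rw [this, card_map, Fin.card_Iio]
  rw [wedge, dif_pos h, Matrix.det_succ_column _ k, hcard, wedgeCons, mul_sum]
  refine sum_congr rfl fun i _ => ?_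
  rw [wedge_eq_det (fun c j => f c (i.succAbove j)) (fun j => e (k.succAbove j))
    (fun a b hab => e.strictMono (Fin.strictMono_succAbove k hab)) hmemC hC]
  rw [Matrix.of_apply, ← he, hk, pow_add]
  simp only [mul_assoc, mul_left_comm]
  rfl

/-- Adding to the column `b` a multiple of the column `p > b` adds a minor in which `p` replaces
`b`; the sign comes from sorting the columns. -/
theorem wedge_step {N : ℕ} {f f' : ℕ → Fin N → R} {B : Finset ℕ} {b p : ℕ} {t : R} (hB : #B = N)
    (hb : b ∈ B) (hbp : b < p) (hf : ∀ c ∈ B, c ≠ b → f c = f' c)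
    (hfb : ∀ i, f b i = f' b i + t * f' p i) :
    wedge f B = wedge f' B + t * if p ∈ B then 0 else
      (-1) ^ #(B.filter fun c => b < c ∧ c < p) * wedge f' (insert p (B.erase b)) := by
  obtain ⟨N, rfl⟩ : ∃ M, N = M + 1 := ⟨N - 1, by have := card_pos.2 ⟨b, hb⟩; omega⟩
  have hC : #(B.erase b) = N := by rw [card_erase_of_mem hb]; omega
  have hbC : b ∉ B.erase b := notMem_erase b B
  have h1 : ∀ F : ℕ → Fin (N + 1) → R, wedge F B =
      (-1) ^ #((B.erase b).filter (· < b)) * wedgeCons (F b) F (B.erase b) := fun F => by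
    rw [← wedge_insert F hbC hC, insert_erase hb]
  rw [h1 f, h1 f', wedgeCons_congr (f b) (f' := f') fun c hc =>
    hf c (mem_of_mem_erase hc) (ne_of_mem_erase hc)]
  rw [show f b = fun i => f' b i + t * f' p i from funext hfb, wedgeCons_add_mul, mul_add]
  congr 1
  split_ifs with hp
  · rw [wedgeCons_self f' (mem_erase.2 ⟨hbp.ne', hp⟩) hC]
    simp
  · rw [wedge_insert f' (fun h => hp (mem_of_mem_erase h)) hC]
    have : #((B.erase b).filter (· < p)) =
        #((B.erase b).filter (· < b)) + #(B.filter fun c => b < c ∧ c < p) := by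
      rw [← card_union_of_disjoint]
      · congr 1
        ext c
        simp only [mem_filter, mem_erase, mem_union]
        grind
      · rw [disjoint_left]; intro c; simp only [mem_filter]; grind
    rw [this, pow_add]
    have h2 : ((-1 : R) ^ #(B.filter fun c => b < c ∧ c < p)) *
        (-1) ^ #(B.filter fun c => b < c ∧ c < p) = 1 := by
      rw [← mul_pow]; simp
    linear_combination (-(t * (-1) ^ #((B.erase b).filter (· < b)) *
      wedgeCons (f' p) f' (B.erase b))) * h2

end Wedge

/-! ### The product of an alternant with a complete symmetric function of powers -/

open Classical in
/-- The sign of the chain of bead moves from `B` to `B'`, which is unique if it exists, and `0`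
otherwise. -/
noncomputable def chainWeight (r p n : ℕ) (B B' : Finset ℕ) : ℤ :=
  if h : ∃ ε, BeadChain r p n B B' ε then h.choose else 0

section ChainWeight

variable {r p n b : ℕ} {B B' : Finset ℕ}

theorem chainWeight_eq {ε : ℤ} (hr : 0 < r) (h : BeadChain r p n B B' ε) :
    chainWeight r p n B B' = ε := by
  have h' : ∃ ε, BeadChain r p n B B' ε := ⟨ε, h⟩
  rw [chainWeight, dif_pos h']
  exact (h'.choose_spec.unique hr h).2

theorem chainWeight_eq_zero (h : ∀ ε, ¬ BeadChain r p n B B' ε) :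
    chainWeight r p n B B' = 0 := by
  rw [chainWeight, dif_neg (by push Not; exact h)]

theorem chainWeight_zero (hr : 0 < r) :
    chainWeight r p 0 B B' = if B = B' then 1 else 0 := by
  split_ifs with h
  · subst h
    exact chainWeight_eq hr (.nil p B)
  · exact chainWeight_eq_zero fun ε hε => by cases hε; exact h rfl

theorem chainWeight_succ (hr : 0 < r) (h : ∀ b ∈ B, b + r = p → p ∈ B) :
    chainWeight r p n B B' = chainWeight r (p + 1) n B B' := by
  by_cases hex : ∃ ε, BeadChain r (p + 1) n B B' ε
  · obtain ⟨ε, hε⟩ := hex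
    rw [chainWeight_eq hr hε, chainWeight_eq hr (hε.mono p.le_succ)]
  · push Not at hex
    rw [chainWeight_eq_zero hex, chainWeight_eq_zero]
    intro ε hε
    cases hε with
    | nil => exact hex _ (.nil _ _)
    | @cons _ n b _ _ ε hb hbr hp hε =>
      have : p ≠ b + r := fun e => hbr (e ▸ h b hb e.symm)
      exact hex _ (.cons hb hbr (by omega) hε)

/-- A chain may use the move of `b` or not; by `BeadChain.not_of_move` at most one choice leads to
a given `B'`. -/
theorem chainWeight_move (hr : 0 < r) (hb : b ∈ B) (hbr : b + r ∉ B) :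
    chainWeight r (b + r) (n + 1) B B' = chainWeight r (b + r + 1) (n + 1) B B' +
      (-1) ^ #(B.filter fun c => b < c ∧ c < b + r) *
        chainWeight r (b + r + 1) n (insert (b + r) (B.erase b)) B' := by
  by_cases h1 : ∃ ε, BeadChain r (b + r + 1) (n + 1) B B' ε
  · obtain ⟨ε, h1⟩ := h1
    rw [chainWeight_eq hr h1, chainWeight_eq hr (h1.mono (Nat.le_succ _)),
      chainWeight_eq_zero fun ε' => h1.not_of_move hr hb (Nat.lt_succ_self _)]
    ring
  · push Not at h1
    rw [chainWeight_eq_zero h1, zero_add]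
    by_cases h2 : ∃ ε, BeadChain r (b + r + 1) n (insert (b + r) (B.erase b)) B' ε
    · obtain ⟨ε, h2⟩ := h2
      rw [chainWeight_eq hr h2, chainWeight_eq hr (.cons hb hbr le_rfl h2)]
    · push Not at h2
      rw [chainWeight_eq_zero h2, mul_zero, chainWeight_eq_zero]
      intro ε hε
      cases hε with
      | @cons _ _ b' _ _ ε hb' hbr' hp hε =>
        rcases eq_or_lt_of_le (Nat.le_of_add_le_add_right hp) with rfl | hlt
        · exact h2 _ hε
        · exact h1 _ (.cons hb' hbr' (by omega) hε)

end ChainWeight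

section GenFun

variable {R : Type*} [CommRing R] {N : ℕ}

/-- The column `(x i ^ b)ᵢ` of an alternant. -/
def powCol (x : Fin N → R) (b : ℕ) (i : Fin N) : R := x i ^ b

/-- The column `(∑ₖ x i ^ (b + k r) tᵏ)ᵢ` with all its shifts by `r` if the first shift leads to a
position `≥ p`, and the column `(x i ^ b)ᵢ` without shifts otherwise. -/
noncomputable def geomCol (x : Fin N → R) (r p b : ℕ) (i : Fin N) : PowerSeries R :=
  if b + r < p then PowerSeries.C (x i ^ b) else PowerSeries.mk fun k => x i ^ (b + k * r)

theorem geomCol_of_lt (x : Fin N → R) {r p b : ℕ} (h : b + r < p) :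
    geomCol x r p b = fun i => PowerSeries.C (powCol x b i) := by
  ext1 i
  rw [geomCol, if_pos h, powCol]

theorem geomCol_succ (x : Fin N → R) {r p b : ℕ} (h : b + r ≠ p) :
    geomCol x r p b = geomCol x r (p + 1) b := by
  ext1 i
  simp only [geomCol]
  exact if_congr (by omega) rfl rfl

/-- Lowering the threshold from `b + r + 1` to `b + r` is a column operation. -/
theorem geomCol_self (x : Fin N → R) {r b : ℕ} (hr : 0 < r) (i : Fin N) :
    geomCol x r (b + r) b i =
      geomCol x r (b + r + 1) b i + PowerSeries.X * geomCol x r (b + r + 1) (b + r) i := by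
  simp only [geomCol]
  rw [if_neg (lt_irrefl _), if_pos (Nat.lt_succ_self _), if_neg (by omega)]
  ext k
  cases k with
  | zero => simp
  | succ k =>
    rw [map_add, PowerSeries.coeff_succ_X_mul, PowerSeries.coeff_mk, PowerSeries.coeff_mk,
      PowerSeries.coeff_C, if_neg k.succ_ne_zero, zero_add]
    congr 1
    ring

/-- Descending induction on the threshold `p = M - k`: every step is one column operation, which
corresponds to the choice whether the chain of bead moves has the target `p`. -/
theorem coeff_wedge_geomCol (x : Fin N → R) {r M : ℕ} (hr : 0 < r) (k : ℕ) :
    ∀ p, p + k = M → ∀ n (B : Finset ℕ), #B = N → (∀ b ∈ B, b + r * n < M) →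
      PowerSeries.coeff n (wedge (geomCol x r p) B) =
        ∑ B' ∈ powersetCard N (range M), (chainWeight r p n B B' : R) * wedge (powCol x) B' := by
  -- the constant coefficients are the alternants themselves
  have h0 : ∀ p (B : Finset ℕ), #B = N → (∀ b ∈ B, b < M) →
      PowerSeries.coeff 0 (wedge (geomCol x r p) B) =
        ∑ B' ∈ powersetCard N (range M), (chainWeight r p 0 B B' : R) * wedge (powCol x) B' := by
    intro p B hB hM
    rw [sum_eq_single B]
    · rw [chainWeight_zero hr, if_pos rfl, Int.cast_one, one_mul,
        PowerSeries.coeff_zero_eq_constantCoeff_apply, map_wedge]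
      congr 1
      ext b i
      simp only [geomCol, powCol]
      split_ifs
      · simp
      · rw [← PowerSeries.coeff_zero_eq_constantCoeff_apply, PowerSeries.coeff_mk]
        simp
    · intro B' _ hne
      rw [chainWeight_zero hr, if_neg hne.symm]
      simp
    · intro h
      exact absurd (mem_powersetCard.2 ⟨fun b hb => mem_range.2 (hM b hb), hB⟩) h
  induction k with
  | zero =>
    rintro p rfl n B hB hM
    cases n with
    | zero => exact h0 p B hB hM
    | succ n =>
      -- no bead of `B` can reach the threshold `M`, and a chain would leave `range M`
      rw [wedge_congr (f' := fun b i => PowerSeries.C (powCol x b i)) fun b hb =>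
        geomCol_of_lt x (by have := hM b hb; rw [mul_add] at this; omega), ← map_wedge,
        PowerSeries.coeff_C, if_neg n.succ_ne_zero, sum_eq_zero]
      intro B' hB'
      rw [chainWeight_eq_zero, Int.cast_zero, zero_mul]
      intro ε hε
      obtain ⟨q, hq, hq'⟩ := hε.exists_le_mem
      have := mem_range.1 ((mem_powersetCard.1 hB').1 hq)
      omega
  | succ k ih =>
    intro p hpM n B hB hM
    cases n with
    | zero => exact h0 p B hB hM
    | succ n =>
      have ih1 := ih (p + 1) (by omega) (n + 1) B hB hM
      by_cases hex : ∃ b ∈ B, b + r = p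
      · obtain ⟨b, hb, rfl⟩ := hex
        rw [wedge_step (f' := geomCol x r (b + r + 1)) hB hb (show b < b + r by omega)
          (fun c _ hc => geomCol_succ x (by omega)) (geomCol_self x hr), map_add, ih1]
        split_ifs with hp
        · simp only [mul_zero, map_zero, add_zero]
          exact sum_congr rfl fun B' _ => by
            rw [chainWeight_succ hr fun _ _ _ => hp]
        · have ih2 := ih (b + r + 1) (by omega) n (insert (b + r) (B.erase b))
            ((card_move hb hp).trans hB) (by
              intro c hc
              rcases mem_insert.1 hc with rfl | hc
              · have := hM b hb
                rw [mul_add] at this; omega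
              · have := hM c (mem_of_mem_erase hc)
                rw [mul_add] at this; omega)
          rw [PowerSeries.coeff_succ_X_mul,
            show ((-1 : PowerSeries R) ^ #(B.filter fun c => b < c ∧ c < b + r)) =
              PowerSeries.C ((-1) ^ #(B.filter fun c => b < c ∧ c < b + r)) by simp,
            PowerSeries.coeff_C_mul, ih2, mul_sum, ← sum_add_distrib]
          refine sum_congr rfl fun B' _ => ?_
          rw [chainWeight_move hr hb hp]
          push_cast
          ring
      · push Not at hex
        rw [wedge_congr fun b hb => geomCol_succ x (hex b hb), ih1]
        exact sum_congr rfl fun B' _ => by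
          rw [chainWeight_succ hr fun b hb e => absurd e (hex b hb)]

/-- The alternant of `B` times `hₙ(x₀ʳ, …, x_{N-1}ʳ)` is the signed sum of the alternants of the
ends of all chains of `n` bead moves. -/
theorem coeff_prod_mul_wedge (x : Fin N → R) {r M n : ℕ} (hr : 0 < r) {B : Finset ℕ} (hB : #B = N)
    (hM : ∀ b ∈ B, b + r * n < M) :
    PowerSeries.coeff n (∏ i, PowerSeries.mk fun k => x i ^ (k * r)) * wedge (powCol x) B =
      ∑ B' ∈ powersetCard N (range M), (chainWeight r 0 n B B' : R) * wedge (powCol x) B' := by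
  rw [← coeff_wedge_geomCol x hr M 0 (by omega) n B hB hM]
  have : wedge (geomCol x r 0) B =
      (∏ i, PowerSeries.mk fun k => x i ^ (k * r)) * PowerSeries.C (wedge (powCol x) B) := by
    rw [map_wedge, wedge, wedge, dif_pos hB, dif_pos hB, ← Matrix.det_mul_column]
    congr 1
    ext i j : 1
    simp only [Matrix.of_apply, geomCol, powCol, Nat.not_lt_zero, if_false]
    ext k
    rw [PowerSeries.coeff_mul_C, PowerSeries.coeff_mk, PowerSeries.coeff_mk, pow_add, mul_comm]
  rw [this, PowerSeries.coeff_mul_C]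

end GenFun

/-! ### Semistandard tableaux with bounded entries -/

/-- Semistandard tableaux of shape `μ` with entries `< N`. -/
def BoundedTableau (N : ℕ) (μ : YoungDiagram) : Type :=
  {T : SemistandardYoungTableau μ // ∀ c ∈ μ.cells, T c.1 c.2 < N}

instance (N : ℕ) (μ : YoungDiagram) : Finite (BoundedTableau N μ) := by
  refine Finite.of_injective
    (fun T : BoundedTableau N μ => fun c : μ.cells => (⟨T.1 c.1.1 c.1.2, T.2 c.1 c.2⟩ : Fin N)) ?_
  intro T T' h
  refine Subtype.ext (SemistandardYoungTableau.ext fun i j => ?_)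
  by_cases hc : (i, j) ∈ μ.cells
  · exact congrArg Fin.val (congrFun h ⟨(i, j), hc⟩)
  · rw [YoungDiagram.mem_cells] at hc
    rw [T.1.zeros hc, T'.1.zeros hc]

noncomputable instance (N : ℕ) (μ : YoungDiagram) : Fintype (BoundedTableau N μ) :=
  Fintype.ofFinite _

theorem le_entry {μ : YoungDiagram} (T : SemistandardYoungTableau μ) {i j : ℕ}
    (h : (i, j) ∈ μ) : i ≤ T i j := by
  induction i with
  | zero => exact Nat.zero_le _
  | succ i ih =>
    exact (ih (μ.up_left_mem i.le_succ le_rfl h)).trans_lt (T.col_strict i.lt_succ_self h)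

/-- `ν` has at most `N` rows and `μ / ν` is a horizontal strip. -/
structure IsStrip (N : ℕ) (ν μ : YoungDiagram) : Prop where
  le : ν ≤ μ
  mem_of_succ_mem : ∀ i j, (i + 1, j) ∈ μ → (i, j) ∈ ν
  rowLen_eq_zero : ν.rowLen N = 0

/-- Young diagrams below a given one are finite in number. -/
theorem finite_le (μ : YoungDiagram) : {ν : YoungDiagram | ν ≤ μ}.Finite := by
  refine Set.Finite.of_finite_image (f := YoungDiagram.cells)
    ((μ.cells.powerset : Finset (Finset (ℕ × ℕ))).finite_toSet.subset ?_) ?_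
  · rintro _ ⟨ν, hν, rfl⟩
    exact mem_powerset.2 (YoungDiagram.cells_subset_iff.2 hν)
  · intro ν _ ν' _ h
    exact YoungDiagram.ext h

instance (N : ℕ) (μ : YoungDiagram) : Finite {ν // IsStrip N ν μ} :=
  ((finite_le μ).subset fun _ h => h.le : {ν | IsStrip N ν μ}.Finite).to_subtype

noncomputable instance (N : ℕ) (μ : YoungDiagram) : Fintype {ν // IsStrip N ν μ} :=
  Fintype.ofFinite _

/-- The shape of the cells of `T` with entries `< N`. -/
def lowerShape {μ : YoungDiagram} (N : ℕ) (T : SemistandardYoungTableau μ) : YoungDiagram where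
  cells := μ.cells.filter fun c => T c.1 c.2 < N
  isLowerSet := by
    rintro ⟨i, j⟩ ⟨i', j'⟩ ⟨hi, hj⟩ h
    simp only [coe_filter, YoungDiagram.mem_cells, Set.mem_ofPred_eq] at h hi hj ⊢
    have h1 : (i', j) ∈ μ := μ.up_left_mem hi le_rfl h.1
    exact ⟨μ.up_left_mem hi hj h.1,
      ((T.row_weak_of_le hj h1).trans (T.col_weak hi h.1)).trans_lt h.2⟩

theorem mem_lowerShape {μ : YoungDiagram} {N : ℕ} {T : SemistandardYoungTableau μ} {i j : ℕ} :
    (i, j) ∈ lowerShape N T ↔ (i, j) ∈ μ ∧ T i j < N := by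
  rw [← YoungDiagram.mem_cells, lowerShape, mem_filter, YoungDiagram.mem_cells]

theorem isStrip_lowerShape {μ : YoungDiagram} {N : ℕ} (T : BoundedTableau (N + 1) μ) :
    IsStrip N (lowerShape N T.1) μ where
  le := by
    rintro ⟨i, j⟩ h
    exact (mem_lowerShape.1 h).1
  mem_of_succ_mem i j h := by
    have h1 : T.1 i j < T.1 (i + 1) j := T.1.col_strict i.lt_succ_self h
    have h2 := T.2 (i + 1, j) h
    exact mem_lowerShape.2 ⟨μ.up_left_mem i.le_succ le_rfl h, by simp only at h2; omega⟩
  rowLen_eq_zero := by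
    by_contra h
    have h1 := (YoungDiagram.mem_iff_lt_rowLen (μ := lowerShape N T.1) (i := N) (j := 0)).2
      (by omega)
    rw [mem_lowerShape] at h1
    have := le_entry T.1 h1.1
    omega

/-- The restriction of `T` to the cells with entries `< N`. -/
def lowerTableau {μ : YoungDiagram} (N : ℕ) (T : SemistandardYoungTableau μ) :
    BoundedTableau N (lowerShape N T) where
  val :=
    { entry := fun i j => if (i, j) ∈ lowerShape N T then T i j else 0
      row_weak' := fun {i j1 j2} hj h => by
        have h1 := (lowerShape N T).up_left_mem le_rfl hj.le h
        rw [if_pos h, if_pos h1]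
        exact T.row_weak hj (mem_lowerShape.1 h).1
      col_strict' := fun {i1 i2 j} hi h => by
        have h1 := (lowerShape N T).up_left_mem hi.le le_rfl h
        rw [if_pos h, if_pos h1]
        exact T.col_strict hi (mem_lowerShape.1 h).1
      zeros' := fun h => if_neg h }
  property := by
    rintro ⟨i, j⟩ h
    change (if (i, j) ∈ lowerShape N T then T i j else 0) < N
    rw [YoungDiagram.mem_cells] at h
    rw [if_pos h]
    exact (mem_lowerShape.1 h).2

/-- The tableau of shape `μ` that extends `T` by entries `N`. -/
def extendTableau {N : ℕ} {μ ν : YoungDiagram} (hν : IsStrip N ν μ) (T : BoundedTableau N ν) :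
    BoundedTableau (N + 1) μ where
  val :=
    { entry := fun i j => if (i, j) ∈ ν then T.1 i j else if (i, j) ∈ μ then N else 0
      row_weak' := fun {i j1 j2} hj h => by
        by_cases h2 : (i, j2) ∈ ν
        · rw [if_pos h2, if_pos (ν.up_left_mem le_rfl hj.le h2)]
          exact T.1.row_weak hj h2
        · rw [if_neg h2, if_pos h]
          split_ifs with h3
          · exact (T.2 (i, j1) h3).le
          · exact le_rfl
          · exact Nat.zero_le _
      col_strict' := fun {i1 i2 j} hi h => by
        have h1 : (i1, j) ∈ ν := hν.mem_of_succ_mem _ _ (μ.up_left_mem hi le_rfl h)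
        rw [if_pos h1]
        by_cases h2 : (i2, j) ∈ ν
        · rw [if_pos h2]
          exact T.1.col_strict hi h2
        · rw [if_neg h2, if_pos h]
          exact T.2 (i1, j) h1
      zeros' := fun h => by rw [if_neg fun h' => h (hν.le h'), if_neg h] }
  property := by
    rintro ⟨i, j⟩ h
    change (if (i, j) ∈ ν then T.1 i j else if (i, j) ∈ μ then N else 0) < N + 1
    split_ifs with h1
    · exact (T.2 (i, j) h1).trans N.lt_succ_self
    · exact N.lt_succ_self
    · exact N.succ_pos

theorem sigma_tableau_ext {N : ℕ} {μ : YoungDiagram}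
    {a b : Σ ν : {ν // IsStrip N ν μ}, BoundedTableau N ν.1} (h : a.1.1 = b.1.1)
    (h' : ∀ i j, a.2.1 i j = b.2.1 i j) : a = b := by
  obtain ⟨⟨ν, hν⟩, T⟩ := a
  obtain ⟨⟨ν', hν'⟩, T'⟩ := b
  obtain rfl : ν = ν' := h
  congr 1
  exact Subtype.ext (SemistandardYoungTableau.ext h')

/-- The branching rule: a tableau with entries `≤ N` is a tableau with entries `< N` together with
a horizontal strip that is filled with the entry `N`. -/
def tableauEquiv (N : ℕ) (μ : YoungDiagram) :
    BoundedTableau (N + 1) μ ≃ Σ ν : {ν // IsStrip N ν μ}, BoundedTableau N ν.1 where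
  toFun T := ⟨⟨lowerShape N T.1, isStrip_lowerShape T⟩, lowerTableau N T.1⟩
  invFun a := extendTableau a.1.2 a.2
  left_inv T := by
    refine Subtype.ext (SemistandardYoungTableau.ext fun i j => ?_)
    change (if (i, j) ∈ lowerShape N T.1 then
      (if (i, j) ∈ lowerShape N T.1 then T.1 i j else 0) else if (i, j) ∈ μ then N else 0) = T.1 i j
    split_ifs with h1 h2
    · rfl
    · have := T.2 (i, j) h2
      rw [mem_lowerShape] at h1
      simp only at this
      by_contra hne
      exact h1 ⟨h2, by omega⟩
    · exact (T.1.zeros h2).symm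
  right_inv := by
    rintro ⟨⟨ν, hν⟩, T⟩
    have hentry : ∀ i j, (extendTableau hν T).1 i j =
      if (i, j) ∈ ν then T.1 i j else if (i, j) ∈ μ then N else 0 := fun _ _ => rfl
    have hshape : lowerShape N (extendTableau hν T).1 = ν := by
      apply YoungDiagram.ext
      ext ⟨i, j⟩
      rw [YoungDiagram.mem_cells, YoungDiagram.mem_cells, mem_lowerShape, hentry]
      constructor
      · rintro ⟨h1, h2⟩
        by_contra h3
        rw [if_neg h3, if_pos h1] at h2
        exact lt_irrefl _ h2
      · intro h
        rw [if_pos h]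
        exact ⟨hν.le h, T.2 (i, j) h⟩
    refine sigma_tableau_ext hshape fun i j => ?_
    change (if (i, j) ∈ lowerShape N (extendTableau hν T).1 then
      (extendTableau hν T).1 i j else 0) = T.1 i j
    rw [hshape, hentry]
    split_ifs with h
    · rfl
    · exact (T.1.zeros h).symm

section TableauSum

variable {R : Type*} [CommRing R]

/-- The Schur polynomial in `x 0, …, x (N - 1)`, as a sum over tableaux. -/
noncomputable def tableauSum (x : ℕ → R) (N : ℕ) (μ : YoungDiagram) : R :=
  ∑ T : BoundedTableau N μ, ∏ c ∈ μ.cells, x (T.1 c.1 c.2)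

theorem tableauSum_succ (x : ℕ → R) (N : ℕ) (μ : YoungDiagram) :
    tableauSum x (N + 1) μ = ∑ ν : {ν // IsStrip N ν μ},
      x N ^ #(μ.cells \ ν.1.cells) * tableauSum x N ν.1 := by
  unfold tableauSum
  simp only [mul_sum]
  rw [← Fintype.sum_sigma', ← (tableauEquiv N μ).sum_comp]
  refine sum_congr rfl fun T _ => ?_
  change _ = x N ^ #(μ.cells \ (lowerShape N T.1).cells) *
    ∏ c ∈ (lowerShape N T.1).cells,
      x (if (c.1, c.2) ∈ lowerShape N T.1 then T.1 c.1 c.2 else 0)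
  rw [← prod_sdiff (YoungDiagram.cells_subset_iff.2 (isStrip_lowerShape T).le)]
  congr 1
  · rw [← prod_const]
    refine prod_congr rfl fun c hc => ?_
    rw [mem_sdiff, YoungDiagram.mem_cells, YoungDiagram.mem_cells] at hc
    have h1 := T.2 c hc.1
    have h2 : ¬ T.1 c.1 c.2 < N := fun h => hc.2 (mem_lowerShape.2 ⟨hc.1, h⟩)
    congr 1
    omega
  · refine prod_congr rfl fun c hc => ?_
    rw [if_pos ((YoungDiagram.mem_cells _).1 hc)]

end TableauSum

/-! ### Alternants and the tableau sum -/

section Alternant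

variable {R : Type*} [CommRing R]

theorem det_sum_columns {N : ℕ} (S : Fin N → Finset ℕ) (g : Fin N → ℕ → Fin N → R) :
    Matrix.det (Matrix.of fun i j => ∑ k ∈ S j, g j k i) =
      ∑ κ ∈ Fintype.piFinset S, Matrix.det (Matrix.of fun i j => g j (κ j) i) := by
  have h := (Matrix.detRowAlternating (n := Fin N) (R := R)).toMultilinearMap.map_sum_finset
    (g := fun j k => g j k) (A := S)
  have h1 : ∀ M : Fin N → Fin N → R,
      (Matrix.detRowAlternating (n := Fin N) (R := R)).toMultilinearMap M =
        Matrix.det (Matrix.of fun i j => M j i) := fun M => (Matrix.det_transpose _).symm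
  rw [h1] at h
  simp only [h1, Finset.sum_apply] at h
  exact h

/-- The branching rule for alternants. Subtracting from each column the preceding one times a power
of `x N` clears the last row and leaves the factor `x i - x N` in the others; the remaining
columns are sums over the exponents between two consecutive exponents. -/
theorem det_pow_succ (x : ℕ → R) {N : ℕ} {e : Fin (N + 1) → ℕ} (he : StrictMono e) :
    Matrix.det (Matrix.of fun i j : Fin (N + 1) => x i ^ e j) =
      (∏ i ∈ range N, (x N - x i)) *
        ∑ κ ∈ Fintype.piFinset fun j : Fin N => Ico (e j.castSucc) (e j.succ),
          x N ^ (e 0 + ∑ j : Fin N, (e j.succ - 1 - κ j)) *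
            Matrix.det (Matrix.of fun i j : Fin N => x i ^ κ j) := by
  set y := x N with hy
  let B : Matrix (Fin (N + 1)) (Fin (N + 1)) R := Matrix.of fun i =>
    Fin.cons (x i ^ e 0) fun j : Fin N =>
      (x i - y) * ∑ k ∈ Ico (e j.castSucc) (e j.succ), x i ^ k * y ^ (e j.succ - 1 - k)
  have hB0 : ∀ i, B i 0 = x i ^ e 0 := fun i => rfl
  have hBs : ∀ i (j : Fin N), B i j.succ =
      (x i - y) * ∑ k ∈ Ico (e j.castSucc) (e j.succ), x i ^ k * y ^ (e j.succ - 1 - k) :=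
    fun i j => rfl
  have hdet : Matrix.det (Matrix.of fun i j : Fin (N + 1) => x i ^ e j) = B.det := by
    refine Matrix.det_eq_of_forall_col_eq_smul_add_pred
      (fun j => y ^ (e j.succ - e j.castSucc)) (fun i => rfl) fun i j => ?_
    rw [hBs, mul_geom_sum₂_Ico _ _ (he j.castSucc_lt_succ).le, Matrix.of_apply, Matrix.of_apply]
    ring
  -- the minor that remains when the last row is cleared
  have hsub : (B.submatrix (Fin.last N).succAbove (0 : Fin (N + 1)).succAbove).det =
      (∏ i : Fin N, (x i - y)) * ∑ κ ∈ Fintype.piFinset fun j : Fin N =>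
        Ico (e j.castSucc) (e j.succ), y ^ (∑ j : Fin N, (e j.succ - 1 - κ j)) *
          Matrix.det (Matrix.of fun i j : Fin N => x i ^ κ j) := by
    have h1 : B.submatrix (Fin.last N).succAbove (0 : Fin (N + 1)).succAbove =
        Matrix.of fun i j : Fin N => (x i - y) * (Matrix.of fun i j : Fin N =>
          ∑ k ∈ Ico (e j.castSucc) (e j.succ), y ^ (e j.succ - 1 - k) * x i ^ k) i j := by
      ext i j
      rw [Matrix.submatrix_apply, Fin.succAbove_zero, hBs, Fin.succAbove_last]
      simp only [Matrix.of_apply, Fin.val_castSucc]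
      congr 1
      exact sum_congr rfl fun k _ => mul_comm _ _
    rw [h1, Matrix.det_mul_column]
    congr 1
    rw [det_sum_columns (fun j : Fin N => Ico (e j.castSucc) (e j.succ))
      fun j k i => y ^ (e j.succ - 1 - k) * x i ^ k]
    refine sum_congr rfl fun κ _ => ?_
    rw [← prod_pow_eq_pow_sum, ← Matrix.det_mul_row]
    rfl
  rw [hdet, Matrix.det_succ_row B (Fin.last N), Fin.sum_univ_succ, sum_eq_zero, add_zero, hB0,
    hsub, ← Fin.prod_univ_eq_prod_range (fun i => y - x i) N]
  · have h2 : ∏ i : Fin N, (y - x i) = (-1) ^ N * ∏ i : Fin N, (x i - y) := by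
      rw [← Fin.prod_const, ← prod_mul_distrib]
      exact prod_congr rfl fun i _ => by ring
    rw [h2, mul_sum, mul_sum, mul_sum]
    refine sum_congr rfl fun κ _ => ?_
    rw [pow_add y]
    simp only [Fin.val_last, Fin.val_zero, add_zero, ← hy]
    ring
  · intro j _
    rw [hBs, Fin.val_last, ← hy, sub_self]
    ring

/-- The beads of `beads N μ` in increasing order. -/
def beadSeq (N : ℕ) (μ : YoungDiagram) (j : Fin N) : ℕ := μ.rowLen (N - 1 - j) + j

theorem beadSeq_strictMono (N : ℕ) (μ : YoungDiagram) : StrictMono (beadSeq N μ) := by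
  intro i j hij
  have := μ.rowLen_anti (N - 1 - j) (N - 1 - i) (by omega)
  have : (i : ℕ) < j := hij
  unfold beadSeq
  omega

theorem beadSeq_mem (N : ℕ) (μ : YoungDiagram) (j : Fin N) : beadSeq N μ j ∈ beads N μ :=
  mem_image.2 ⟨N - 1 - j, by rw [mem_range]; omega, by unfold beadSeq; omega⟩

theorem wedge_powCol_beads {N : ℕ} (x : Fin N → R) (μ : YoungDiagram) :
    wedge (powCol x) (beads N μ) = Matrix.det (Matrix.of fun i j => x i ^ beadSeq N μ j) :=
  wedge_eq_det _ _ (beadSeq_strictMono N μ) (beadSeq_mem N μ) (card_beads N μ)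

theorem card_skew {N : ℕ} {μ ν : YoungDiagram} (hμ : μ.rowLen N = 0) :
    #(μ.cells \ ν.cells) = ∑ i ∈ range N, (μ.rowLen i - ν.rowLen i) := by
  have hmaps : Set.MapsTo Prod.fst ((μ.cells \ ν.cells : Finset (ℕ × ℕ)) : Set (ℕ × ℕ))
      ((range N : Finset ℕ) : Set ℕ) := by
    rintro ⟨i, j⟩ hc
    rw [mem_coe, mem_sdiff, YoungDiagram.mem_cells, YoungDiagram.mem_iff_lt_rowLen] at hc
    rw [mem_coe, mem_range]
    by_contra h
    have := μ.rowLen_anti N i (not_lt.1 h)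
    omega
  rw [card_eq_sum_card_fiberwise hmaps]
  refine sum_congr rfl fun i _ => ?_
  have : (μ.cells \ ν.cells).filter (fun c => c.1 = i) =
      (Ico (ν.rowLen i) (μ.rowLen i)).image fun j => (i, j) := by
    ext ⟨i', j⟩
    simp only [mem_filter, mem_sdiff, YoungDiagram.mem_cells, YoungDiagram.mem_iff_lt_rowLen,
      mem_image, mem_Ico, Prod.mk.injEq]
    constructor
    · rintro ⟨h, rfl⟩
      exact ⟨j, by omega, rfl, rfl⟩
    · rintro ⟨_, h, rfl, rfl⟩
      exact ⟨by omega, rfl⟩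
  rw [this, card_image_of_injective _ (Prod.mk_right_injective i), Nat.card_Ico]

theorem isStrip_iff {N : ℕ} {μ ν : YoungDiagram} (hμ : μ.rowLen (N + 1) = 0)
    (hν : ν.rowLen N = 0) : IsStrip N ν μ ↔
      ∀ j : Fin N, beadSeq N ν j ∈
        Ico (beadSeq (N + 1) μ j.castSucc) (beadSeq (N + 1) μ j.succ) := by
  -- the interlacing condition on the row lengths
  have hrow : IsStrip N ν μ ↔
      ∀ i < N, μ.rowLen (i + 1) ≤ ν.rowLen i ∧ ν.rowLen i ≤ μ.rowLen i := by
    constructor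
    · intro h i _
      constructor
      · by_contra hlt
        have := h.mem_of_succ_mem i (ν.rowLen i) (YoungDiagram.mem_iff_lt_rowLen.2 (by omega))
        exact lt_irrefl _ (YoungDiagram.mem_iff_lt_rowLen.1 this)
      · by_contra hlt
        have : (i, μ.rowLen i) ∈ μ :=
          h.le (show (i, μ.rowLen i) ∈ ν from YoungDiagram.mem_iff_lt_rowLen.2 (by omega))
        exact lt_irrefl _ (YoungDiagram.mem_iff_lt_rowLen.1 this)
    · intro h
      refine ⟨?_, ?_, hν⟩
      · rintro ⟨i, j⟩ hc
        have hc : (i, j) ∈ ν := hc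
        change (i, j) ∈ μ
        rw [YoungDiagram.mem_iff_lt_rowLen] at hc ⊢
        rcases lt_or_ge i N with hi | hi
        · exact hc.trans_le (h i hi).2
        · have := ν.rowLen_anti N i hi
          omega
      · intro i j hc
        rw [YoungDiagram.mem_iff_lt_rowLen] at hc ⊢
        rcases lt_or_ge i N with hi | hi
        · exact hc.trans_le (h i hi).1
        · have := μ.rowLen_anti (N + 1) (i + 1) (by omega)
          omega
  rw [hrow]
  simp only [beadSeq, mem_Ico, Fin.val_castSucc, Fin.val_succ]
  constructor
  · intro h j
    have h1 := h (N - 1 - j) (by omega)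
    rw [show N - 1 - (j : ℕ) + 1 = N + 1 - 1 - j by omega] at h1
    rw [show N + 1 - 1 - ((j : ℕ) + 1) = N - 1 - j by omega]
    omega
  · intro h i hi
    have h1 := h ⟨N - 1 - i, by omega⟩
    simp only at h1
    rw [show N + 1 - 1 - (N - 1 - i) = i + 1 by omega,
      show N + 1 - 1 - (N - 1 - i + 1) = i by omega, show N - 1 - (N - 1 - i) = i by omega] at h1
    omega

theorem card_strip {N : ℕ} {μ ν : YoungDiagram} (hμ : μ.rowLen (N + 1) = 0)
    (hν : ν.rowLen N = 0) : #(μ.cells \ ν.cells) =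
      beadSeq (N + 1) μ 0 + ∑ j : Fin N, (beadSeq (N + 1) μ j.succ - 1 - beadSeq N ν j) := by
  rw [card_skew hμ, sum_range_succ, add_comm, hν, ← sum_range_reflect, Finset.sum_range]
  congr 1
  refine sum_congr rfl fun j _ => ?_
  simp only [beadSeq, Fin.val_succ]
  rw [show N + 1 - 1 - ((j : ℕ) + 1) = N - 1 - j by omega]
  omega

/-- The Vandermonde product `∏_{i < k < N} (x k - x i)`. -/
def vandermondeProd (x : ℕ → R) (N : ℕ) : R := ∏ k ∈ range N, ∏ i ∈ range k, (x k - x i)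

theorem exists_beadSeq_eq {N : ℕ} {κ : Fin N → ℕ} (hκ : StrictMono κ) :
    ∃ ν : YoungDiagram, ν.rowLen N = 0 ∧ beadSeq N ν = κ := by
  have hcard : #(univ.image κ) = N := by
    rw [card_image_of_injective _ hκ.injective, card_univ, Fintype.card_fin]
  obtain ⟨ν, hν, hB⟩ := exists_beads_eq (univ.image κ)
  rw [hcard] at hν hB
  refine ⟨ν, hν, ?_⟩
  rw [orderEmbOfFin_unique (card_beads N ν) (beadSeq_mem N ν) (beadSeq_strictMono N ν),
    ← orderEmbOfFin_unique (card_beads N ν) (fun j => ?_) hκ]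
  rw [hB]
  exact mem_image_of_mem _ (mem_univ j)

theorem beadSeq_injective {N : ℕ} {μ ν : YoungDiagram} (hμ : μ.rowLen N = 0)
    (hν : ν.rowLen N = 0) (h : beadSeq N μ = beadSeq N ν) : μ = ν := by
  have key : ∀ μ : YoungDiagram, beads N μ = univ.image (beadSeq N μ) := fun μ =>
    (eq_of_subset_of_card_le (image_subset_iff.2 fun j _ => beadSeq_mem N μ j) (by
      rw [card_image_of_injective _ (beadSeq_strictMono N μ).injective, card_beads, card_univ,
        Fintype.card_fin])).symm
  exact beads_injective hμ hν (by rw [key, key, h])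

/-- The bialternant formula: both sides satisfy the same branching rule. -/
theorem det_beadSeq (x : ℕ → R) (N : ℕ) : ∀ μ : YoungDiagram, μ.rowLen N = 0 →
    Matrix.det (Matrix.of fun i j : Fin N => x i ^ beadSeq N μ j) =
      vandermondeProd x N * tableauSum x N μ := by
  induction N with
  | zero =>
    intro μ hμ
    have hcells : μ.cells = ∅ := by
      rw [eq_empty_iff_forall_notMem]
      rintro ⟨i, j⟩ hc
      rw [YoungDiagram.mem_cells, YoungDiagram.mem_iff_lt_rowLen] at hc
      have := μ.rowLen_anti 0 i (Nat.zero_le _)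
      omega
    have huniq : Fintype.card (BoundedTableau 0 μ) = 1 := by
      rw [Fintype.card_eq_one_iff]
      refine ⟨⟨.highestWeight μ, fun c hc => by simp [hcells] at hc⟩, fun T => ?_⟩
      refine Subtype.ext (SemistandardYoungTableau.ext fun i j => ?_)
      have hc : (i, j) ∉ μ := by
        rw [← YoungDiagram.mem_cells, hcells]; exact notMem_empty _
      rw [T.1.zeros hc, SemistandardYoungTableau.zeros _ hc]
    have hone : ∀ T : BoundedTableau 0 μ, ∏ c ∈ μ.cells, x (T.1 c.1 c.2) = 1 := fun T =>
      prod_eq_one fun c hc => by simp [hcells] at hc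
    rw [Matrix.det_fin_zero, vandermondeProd, tableauSum, range_zero, prod_empty, one_mul,
      sum_congr rfl fun T _ => hone T, sum_const, card_univ, huniq, one_smul]
  | succ N ih =>
    intro μ hμ
    rw [det_pow_succ x (beadSeq_strictMono (N + 1) μ), tableauSum_succ, vandermondeProd,
      prod_range_succ, mul_comm (∏ k ∈ range N, ∏ i ∈ range k, (x k - x i)), mul_assoc]
    congr 1
    rw [mul_sum]
    symm
    refine sum_bij (fun (ν : {ν // IsStrip N ν μ}) _ => beadSeq N ν.1) ?_ ?_ ?_ ?_
    · intro ν _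
      exact Fintype.mem_piFinset.2 ((isStrip_iff hμ ν.2.rowLen_eq_zero).1 ν.2)
    · intro ν _ ν' _ h
      exact Subtype.ext (beadSeq_injective ν.2.rowLen_eq_zero ν'.2.rowLen_eq_zero h)
    · intro κ hκ
      rw [Fintype.mem_piFinset] at hκ
      have hmono : StrictMono κ := by
        intro i j hij
        have h1 := (mem_Ico.1 (hκ i)).2
        have h2 := (mem_Ico.1 (hκ j)).1
        have h3 := (beadSeq_strictMono (N + 1) μ).monotone (show i.succ ≤ j.castSucc from hij)
        omega
      obtain ⟨ν, hν, rfl⟩ := exists_beadSeq_eq hmono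
      exact ⟨⟨ν, (isStrip_iff hμ hν).2 hκ⟩, mem_univ _, rfl⟩
    · intro ν _
      rw [ih ν.1 ν.2.rowLen_eq_zero, card_strip hμ ν.2.rowLen_eq_zero, vandermondeProd]
      ring

end Alternant

/-! ### The rule in one alphabet -/

/-- `f` and `g` have the same coefficients at all monomials in the variables `x (k, j)`, `j < N`. -/
def AgreeBelow (N : ℕ) (f g : PolySeries) : Prop :=
  ∀ m : ℕ+ × ℕ →₀ ℕ, (∀ v ∈ m.support, v.2 < N) → MvPowerSeries.coeff m f = MvPowerSeries.coeff m g

namespace AgreeBelow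

variable {N : ℕ} {f f' g g' : PolySeries}

theorem symm (h : AgreeBelow N f g) : AgreeBelow N g f := fun m hm => (h m hm).symm

theorem trans (h : AgreeBelow N f g) (h' : AgreeBelow N g g') : AgreeBelow N f g' :=
  fun m hm => (h m hm).trans (h' m hm)

theorem mul (h : AgreeBelow N f g) (h' : AgreeBelow N f' g') : AgreeBelow N (f * f') (g * g') := by
  intro m hm
  rw [MvPowerSeries.coeff_mul, MvPowerSeries.coeff_mul]
  refine sum_congr rfl fun p hp => ?_
  rw [HasAntidiagonal.mem_antidiagonal] at hp
  have h1 : ∀ v ∈ p.1.support, v.2 < N := fun v hv => hm v (by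
    rw [Finsupp.mem_support_iff] at hv ⊢
    rw [← hp, Finsupp.add_apply]; omega)
  have h2 : ∀ v ∈ p.2.support, v.2 < N := fun v hv => hm v (by
    rw [Finsupp.mem_support_iff] at hv ⊢
    rw [← hp, Finsupp.add_apply]; omega)
  rw [h _ h1, h' _ h2]

theorem sum_smul {ι : Type*} (s : Finset ι) (c : ι → ℚ) {F G : ι → PolySeries}
    (h : ∀ i ∈ s, AgreeBelow N (F i) (G i)) :
    AgreeBelow N (∑ i ∈ s, c i • F i) (∑ i ∈ s, c i • G i) := by
  intro m hm
  rw [map_sum, map_sum]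
  exact sum_congr rfl fun i hi => by
    rw [MvPowerSeries.coeff_smul, MvPowerSeries.coeff_smul, h i hi m hm]

end AgreeBelow

/-- A series is determined by its truncations to finitely many variables of each degree. -/
theorem eq_of_agreeBelow {f g : PolySeries} {N₀ : ℕ} (h : ∀ N, N₀ ≤ N → AgreeBelow N f g) :
    f = g := by
  ext m
  refine h (max N₀ (m.support.sup Prod.snd + 1)) (le_max_left _ _) m fun v hv => ?_
  exact lt_max_of_lt_right (Nat.lt_succ_of_le (le_sup (f := Prod.snd) hv))

theorem prod_X_eq_monomial {ι : Type*} (s : Finset ι) (v : ι → ℕ+ × ℕ) (a : ι → ℕ) :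
    ∏ i ∈ s, (MvPowerSeries.X (v i) : PolySeries) ^ a i =
      MvPowerSeries.monomial (∑ i ∈ s, Finsupp.single (v i) (a i)) 1 := by
  classical
  induction s using Finset.induction_on with
  | empty => simp
  | insert i s hi ih =>
    rw [prod_insert hi, sum_insert hi, ih, MvPowerSeries.X_pow_eq,
      MvPowerSeries.monomial_mul_monomial, one_mul]

theorem agreeBelow_schur (k : ℕ+) (N : ℕ) (μ : YoungDiagram) :
    AgreeBelow N (PolySeries.schur k μ)
      (tableauSum (fun i => (MvPowerSeries.X (k, i) : PolySeries)) N μ) := by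
  classical
  intro m hm
  have h1 : ∀ T : BoundedTableau N μ,
      ∏ c ∈ μ.cells, (MvPowerSeries.X (k, T.1 c.1 c.2) : PolySeries) =
        MvPowerSeries.monomial (∑ c ∈ μ.cells, Finsupp.single (k, T.1 c.1 c.2) 1) 1 := fun T => by
    rw [← prod_X_eq_monomial]
    simp
  rw [tableauSum, map_sum, sum_congr rfl fun T _ => by
    rw [h1 T, MvPowerSeries.coeff_monomial], sum_boole]
  change ((Nat.card _ : ℕ) : ℚ) = _
  congr 1
  rw [← Fintype.card_subtype, ← Nat.card_eq_fintype_card]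
  refine Nat.card_congr ⟨fun T => ⟨⟨T.1, fun c hc => ?_⟩, T.2.symm⟩, fun T => ⟨T.1.1, T.2.symm⟩,
    fun T => rfl, fun T => rfl⟩
  obtain ⟨T, rfl⟩ := T
  refine hm (k, T c.1 c.2) ?_
  rw [Finsupp.mem_support_iff, Finsupp.finsetSum_apply]
  refine (sum_pos' (fun _ _ => Nat.zero_le _) ⟨c, hc, ?_⟩).ne'
  simp

open Classical in
/-- The complete homogeneous symmetric function `hₙ` in the variables `x (k, j) ^ r`, `j ≥ 0`. -/
noncomputable def completePower (k : ℕ+) (r n : ℕ) : PolySeries := fun m =>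
  if ∃ m' : ℕ+ × ℕ →₀ ℕ, m = r • m' ∧ (∀ v ∈ m'.support, v.1 = k) ∧ m'.degree = n then 1 else 0

theorem agreeBelow_completePower (k : ℕ+) {r : ℕ} (hr : 0 < r) (n N : ℕ) :
    AgreeBelow N (completePower k r n) (PowerSeries.coeff n (∏ i : Fin N,
      PowerSeries.mk fun j => (MvPowerSeries.X (k, (i : ℕ)) : PolySeries) ^ (j * r))) := by
  classical
  intro m hm
  rw [PowerSeries.coeff_prod]
  simp only [PowerSeries.coeff_mk]
  rw [map_sum, sum_congr rfl fun l _ => by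
    rw [prod_X_eq_monomial univ (fun i : Fin N => (k, (i : ℕ))) fun i => l i * r,
      MvPowerSeries.coeff_monomial]]
  have happ : ∀ (a : Fin N → ℕ) (i : Fin N),
      (∑ i : Fin N, Finsupp.single (k, (i : ℕ)) (a i)) (k, (i : ℕ)) = a i := by
    intro a i
    rw [Finsupp.finsetSum_apply, sum_eq_single i]
    · simp
    · intro j _ hj
      rw [Finsupp.single_apply, if_neg]
      simpa [Fin.val_inj] using hj
    · simp
  have hsupp : ∀ (a : Fin N → ℕ) (v : ℕ+ × ℕ),
      (∑ i : Fin N, Finsupp.single (k, (i : ℕ)) (a i)) v ≠ 0 → v.1 = k := by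
    intro a v hv
    rw [Finsupp.finsetSum_apply] at hv
    obtain ⟨i, -, hi⟩ := exists_ne_zero_of_sum_ne_zero hv
    by_contra hne
    rw [Finsupp.single_apply, if_neg fun e => hne (by rw [← e])] at hi
    exact hi rfl
  change (if _ then _ else _) = _
  split_ifs with h
  · obtain ⟨m', rfl, hk, hn⟩ := h
    have hm' : ∀ v ∈ m'.support, v.2 < N := fun v hv => hm v (by
      rw [Finsupp.mem_support_iff] at hv ⊢
      simp only [Finsupp.smul_apply, smul_eq_mul]
      exact mul_ne_zero hr.ne' hv)
    -- the exponents of `m'` are the only ones that contribute, and they contribute once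
    have hrep : m' = ∑ i : Fin N, Finsupp.single (k, (i : ℕ)) (m' (k, i)) := by
      ext v
      by_cases hv : v ∈ m'.support
      · obtain ⟨k', j⟩ := v
        obtain rfl : k' = k := hk _ hv
        exact (happ (fun i => m' (k', i)) ⟨j, hm' _ hv⟩).symm
      · rw [Finsupp.notMem_support_iff] at hv
        rw [hv]
        by_contra hne
        have h1 := hsupp _ v (Ne.symm hne)
        rw [Finsupp.finsetSum_apply] at hne
        refine hne (sum_eq_zero fun i _ => ?_).symm
        rw [Finsupp.single_apply]
        split_ifs with e
        · rw [e, hv]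
        · rfl
    have hr' : r • m' = ∑ i : Fin N, Finsupp.single (k, (i : ℕ)) (m' (k, i) * r) := by
      conv_lhs => rw [hrep]
      rw [smul_sum]
      exact sum_congr rfl fun i _ => by rw [Finsupp.smul_single, smul_eq_mul, mul_comm]
    rw [sum_eq_single (Finsupp.equivFunOnFinite.symm fun i : Fin N => m' (k, i))]
    · rw [if_pos]
      simpa using hr'
    · intro l _ hl
      rw [if_neg]
      intro e
      refine hl (Finsupp.ext fun i => ?_)
      have h1 := DFunLike.congr_fun e (k, (i : ℕ))
      rw [happ (fun i => l i * r), Finsupp.smul_apply, smul_eq_mul, mul_comm] at h1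
      exact (Nat.eq_of_mul_eq_mul_right hr h1).symm
    · intro hl
      refine absurd ?_ hl
      rw [mem_finsuppAntidiag]
      refine ⟨?_, subset_univ _⟩
      rw [← hn]
      conv_rhs => rw [hrep, map_sum]
      simp
  · symm
    refine sum_eq_zero fun l hl => if_neg fun e => h ?_
    refine ⟨∑ i : Fin N, Finsupp.single (k, (i : ℕ)) (l i), ?_, ?_, ?_⟩
    · rw [e, smul_sum]
      exact sum_congr rfl fun i _ => by rw [Finsupp.smul_single, smul_eq_mul, mul_comm]
    · intro v hv
      exact hsupp _ v (Finsupp.mem_support_iff.1 hv)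
    · rw [map_sum]
      simpa using (mem_finsuppAntidiag.1 hl).1

theorem vandermondeProd_X_ne_zero (k : ℕ+) (N : ℕ) :
    vandermondeProd (fun i => (MvPowerSeries.X (k, i) : PolySeries)) N ≠ 0 := by
  refine prod_ne_zero_iff.2 fun a _ => prod_ne_zero_iff.2 fun b hb => sub_ne_zero.2 fun h => ?_
  have h1 := MvPowerSeries.X_inj.1 h
  rw [Prod.mk.injEq] at h1
  rw [mem_range] at hb
  omega

theorem rowLen_le_card (μ : YoungDiagram) (i : ℕ) : μ.rowLen i ≤ μ.card := by
  rw [YoungDiagram.rowLen_eq_card]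
  exact card_le_card (filter_subset _ _)

theorem rowLen_eq_zero_of_card_le {μ : YoungDiagram} {N : ℕ} (h : μ.card ≤ N) :
    μ.rowLen N = 0 := by
  by_contra h0
  have h1 : (range (N + 1)).image (fun i => (i, 0)) ⊆ μ.cells := by
    rw [image_subset_iff]
    intro i hi
    rw [YoungDiagram.mem_cells]
    rw [mem_range] at hi
    exact μ.up_left_mem (by omega) le_rfl
      (YoungDiagram.mem_iff_lt_rowLen.2 (Nat.pos_of_ne_zero h0))
  have h2 := card_le_card h1
  rw [card_image_of_injective _ (fun a b h => (Prod.mk.inj h).1), card_range] at h2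
  have : #μ.cells = μ.card := rfl
  omega

theorem finite_isPolyribbon (r n : ℕ) (μ : YoungDiagram) :
    {ν : YoungDiagram | IsPolyribbon r n μ ν}.Finite := by
  set c := μ.card + n * r with hc
  refine Set.Finite.of_finite_image (f := YoungDiagram.cells)
    (((range c ×ˢ range c).powerset : Finset (Finset (ℕ × ℕ))).finite_toSet.subset ?_) ?_
  · rintro _ ⟨ν, hν, rfl⟩
    rw [mem_coe, mem_powerset]
    rintro ⟨i, j⟩ h
    rw [YoungDiagram.mem_cells, YoungDiagram.mem_iff_lt_rowLen] at h
    have hν : ν.card = c := IsPolyribbon.card_eq hν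
    rw [mem_product, mem_range, mem_range]
    refine ⟨?_, ?_⟩
    · by_contra hi
      have h1 := rowLen_eq_zero_of_card_le (hν.trans_le (not_lt.1 hi))
      simp only at h1
      omega
    · exact (h.trans_le (rowLen_le_card ν i)).trans_eq hν
  · intro ν _ ν' _ h
    exact YoungDiagram.ext h

/-- The finite set of the `ν` for which `ν / μ` is an `r ^ n`-polyribbon. -/
noncomputable def polyribbons (r n : ℕ) (μ : YoungDiagram) : Finset YoungDiagram :=
  (finite_isPolyribbon r n μ).toFinset

theorem mem_polyribbons {r n : ℕ} {μ ν : YoungDiagram} :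
    ν ∈ polyribbons r n μ ↔ IsPolyribbon r n μ ν := by
  simp [polyribbons]

/-- The rule in finitely many variables. The hypothesis `hN` ensures that no `ν` in the sum has
more than `N` rows. -/
theorem tableauSum_mul (x : ℕ → PolySeries) {r n N : ℕ} {μ : YoungDiagram} (hr : 0 < r)
    (hx : vandermondeProd x N ≠ 0) (hN : μ.card + n * r ≤ N) :
    tableauSum x N μ * PowerSeries.coeff n (∏ i : Fin N, PowerSeries.mk fun j => x i ^ (j * r)) =
      ∑ ν ∈ polyribbons r n μ, (polyribbonSign r μ ν : ℚ) • tableauSum x N ν := by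
  have hμ : μ.rowLen N = 0 := rowLen_eq_zero_of_card_le (by omega)
  have hcard : ∀ ν ∈ polyribbons r n μ, ν.card = μ.card + n * r := fun ν hν =>
    (mem_polyribbons.1 hν).card_eq
  have hrow : ∀ ν ∈ polyribbons r n μ, ν.rowLen N = 0 := fun ν hν =>
    rowLen_eq_zero_of_card_le (by rw [hcard ν hν]; exact hN)
  have hbd : ∀ (ν : YoungDiagram), ∀ b ∈ beads N ν, b ≤ ν.card + N := by
    intro ν b hb
    obtain ⟨i, -, rfl⟩ := mem_image.1 hb
    have := rowLen_le_card ν i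
    omega
  set M := μ.card + n * r + N + 1 with hM
  have key := coeff_prod_mul_wedge (fun i : Fin N => x i) (M := M) hr (card_beads N μ)
    (n := n) fun b hb => by
      have := hbd μ b hb
      rw [mul_comm r n]
      omega
  rw [wedge_powCol_beads, det_beadSeq x N μ hμ] at key
  -- the bead sets that are ends of chains are those of the polyribbons
  have hsum : ∑ B' ∈ powersetCard N (range M),
      (chainWeight r 0 n (beads N μ) B' : PolySeries) * wedge (powCol fun i : Fin N => x i) B' =
      ∑ ν ∈ polyribbons r n μ,
        (polyribbonSign r μ ν : PolySeries) * (vandermondeProd x N * tableauSum x N ν) := by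
    have himg : (polyribbons r n μ).image (beads N) ⊆ powersetCard N (range M) := by
      rw [image_subset_iff]
      intro ν hν
      refine mem_powersetCard.2 ⟨fun b hb => mem_range.2 ?_, card_beads N ν⟩
      have := hbd ν b hb
      rw [hcard ν hν] at this
      omega
    rw [← sum_subset himg, sum_image]
    · refine sum_congr rfl fun ν hν => ?_
      obtain ⟨ε, hε⟩ := (isPolyribbon_iff hr hμ (hrow ν hν)).1 (mem_polyribbons.1 hν)
      rw [chainWeight_eq hr hε, polyribbonSign_eq hr hμ (hrow ν hν) hε, wedge_powCol_beads,
        det_beadSeq x N ν (hrow ν hν)]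
    · intro ν hν ν' hν' h
      exact beads_injective (hrow ν hν) (hrow ν' hν') h
    · intro B' hB' hnot
      rw [chainWeight_eq_zero, Int.cast_zero, zero_mul]
      intro ε hε
      obtain ⟨ν, hν, hνB⟩ := exists_beads_eq B'
      rw [(mem_powersetCard.1 hB').2] at hν hνB
      refine hnot (mem_image.2 ⟨ν, mem_polyribbons.2 ?_, hνB⟩)
      exact (isPolyribbon_iff hr hμ hν).2 ⟨ε, hνB ▸ hε⟩
  rw [hsum] at key
  refine mul_left_cancel₀ hx ?_
  rw [mul_sum]
  calc _ = PowerSeries.coeff n (∏ i : Fin N, PowerSeries.mk fun j => x i ^ (j * r)) *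
        (vandermondeProd x N * tableauSum x N μ) := by ring
    _ = _ := key
    _ = _ := sum_congr rfl fun ν _ => by
      rw [Algebra.smul_def, map_intCast]
      ring

/-- The plethystic Pieri rule in the variables of one degree. -/
theorem schur_mul_completePower (k : ℕ+) {r : ℕ} (hr : 0 < r) (n : ℕ) (μ : YoungDiagram) :
    PolySeries.schur k μ * completePower k r n =
      ∑ ν ∈ polyribbons r n μ, (polyribbonSign r μ ν : ℚ) • PolySeries.schur k ν := by
  refine eq_of_agreeBelow (N₀ := μ.card + n * r) fun N hN => ?_
  have h1 := (agreeBelow_schur k N μ).mul (agreeBelow_completePower k hr n N)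
  rw [tableauSum_mul _ hr (vandermondeProd_X_ne_zero k N) hN] at h1
  exact h1.trans (AgreeBelow.sum_smul _ _ fun ν _ => (agreeBelow_schur k N ν).symm)

/-! ### Factorization of the signed series -/

/-- The multiset of the degrees of the variables of the monomial `m`, with multiplicity. -/
noncomputable def degrees (m : ℕ+ × ℕ →₀ ℕ) : Multiset ℕ :=
  (Finsupp.toMultiset m).map fun v => (v.1 : ℕ)

theorem degrees_add (m m' : ℕ+ × ℕ →₀ ℕ) : degrees (m + m') = degrees m + degrees m' := by
  simp [degrees]

theorem mem_degrees {m : ℕ+ × ℕ →₀ ℕ} {k : ℕ+} :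
    (k : ℕ) ∈ degrees m ↔ ∃ v ∈ m.support, v.1 = k := by
  simp only [degrees, Multiset.mem_map, Finsupp.mem_toMultiset, PNat.coe_inj]

theorem pos_of_mem_degrees {m : ℕ+ × ℕ →₀ ℕ} {i : ℕ} (h : i ∈ degrees m) : 0 < i := by
  obtain ⟨v, -, rfl⟩ := Multiset.mem_map.1 h
  exact v.1.pos

theorem card_degrees (m : ℕ+ × ℕ →₀ ℕ) : Multiset.card (degrees m) = m.degree := by
  rw [degrees, Multiset.card_map, Finsupp.card_toMultiset]
  rfl

theorem sum_degrees (m : ℕ+ × ℕ →₀ ℕ) :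
    (degrees m).sum = ∑ v ∈ m.support, (v.1 : ℕ) * m v := by
  classical
  rw [degrees, Finset.sum_multiset_map_count, Finsupp.toFinset_toMultiset]
  exact sum_congr rfl fun v _ => by rw [Finsupp.count_toMultiset, smul_eq_mul, mul_comm]

theorem degrees_eq_replicate {m : ℕ+ × ℕ →₀ ℕ} {k : ℕ+} (h : ∀ v ∈ m.support, v.1 = k) :
    degrees m = Multiset.replicate m.degree (k : ℕ) := by
  rw [← card_degrees, Multiset.eq_replicate_card]
  intro i hi
  obtain ⟨v, hv, rfl⟩ := Multiset.mem_map.1 hi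
  rw [h v ((Finsupp.mem_toMultiset _ _).1 hv)]

open Classical in
/-- The sum of the monomials `∏ (x (k, j) ^ r) ^ m' (k, j)` whose variables have degrees in `K`
and which contain exactly `a k` variables `x (k, j) ^ r` of each degree `k ∈ K`, counted with
multiplicity. -/
noncomputable def multiPower (K : Finset ℕ+) (r : ℕ) (a : ℕ+ → ℕ) : PolySeries := fun m =>
  if ∃ m' : ℕ+ × ℕ →₀ ℕ, m = r • m' ∧ (∀ v ∈ m'.support, v.1 ∈ K) ∧
    ∀ k ∈ K, (degrees m').count (k : ℕ) = a k then 1 else 0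

theorem smul_left_cancel {r : ℕ} (hr : 0 < r) {m m' : ℕ+ × ℕ →₀ ℕ} (h : r • m = r • m') :
    m = m' := by
  ext v
  have := DFunLike.congr_fun h v
  exact Nat.eq_of_mul_eq_mul_left hr this

open Classical in
theorem coeff_completePower (k : ℕ+) (r n : ℕ) (m : ℕ+ × ℕ →₀ ℕ) :
    MvPowerSeries.coeff m (completePower k r n) =
      if ∃ m' : ℕ+ × ℕ →₀ ℕ, m = r • m' ∧ (∀ v ∈ m'.support, v.1 = k) ∧ m'.degree = n
      then 1 else 0 := rfl

open Classical in
theorem coeff_multiPower (K : Finset ℕ+) (r : ℕ) (a : ℕ+ → ℕ) (m : ℕ+ × ℕ →₀ ℕ) :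
    MvPowerSeries.coeff m (multiPower K r a) =
      if ∃ m' : ℕ+ × ℕ →₀ ℕ, m = r • m' ∧ (∀ v ∈ m'.support, v.1 ∈ K) ∧
        ∀ k ∈ K, (degrees m').count (k : ℕ) = a k then 1 else 0 := rfl

theorem multiPower_insert {K : Finset ℕ+} {k : ℕ+} (hk : k ∉ K) {r : ℕ} (hr : 0 < r)
    (a : ℕ+ → ℕ) :
    multiPower (insert k K) r a = completePower k r (a k) * multiPower K r a := by
  classical
  -- an exponent for the enlarged alphabet is a sum of exponents for the two parts
  have hsum : ∀ m₁ m₂ : ℕ+ × ℕ →₀ ℕ, (∀ v ∈ m₁.support, v.1 = k) → (∀ v ∈ m₂.support, v.1 ∈ K) →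
      (∀ v ∈ (m₁ + m₂).support, v.1 ∈ insert k K) ∧
        (degrees (m₁ + m₂)).count (k : ℕ) = m₁.degree ∧
        ∀ j ∈ K, (degrees (m₁ + m₂)).count (j : ℕ) = (degrees m₂).count (j : ℕ) := by
    intro m₁ m₂ h1 h2
    refine ⟨fun v hv => ?_, ?_, fun j hj => ?_⟩
    · rcases mem_union.1 (Finsupp.support_add hv) with h | h
      · exact mem_insert.2 (Or.inl (h1 v h))
      · exact mem_insert_of_mem (h2 v h)
    · rw [degrees_add, Multiset.count_add, degrees_eq_replicate h1, Multiset.count_replicate_self,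
        Multiset.count_eq_zero_of_notMem, add_zero]
      rw [mem_degrees]
      rintro ⟨v, hv, rfl⟩
      exact hk (h2 v hv)
    · rw [degrees_add, Multiset.count_add, degrees_eq_replicate h1, Multiset.count_replicate,
        if_neg, zero_add]
      rw [PNat.coe_inj]
      rintro rfl
      exact hk hj
  ext m
  rw [MvPowerSeries.coeff_mul, coeff_multiPower]
  split_ifs with h
  · obtain ⟨m', rfl, h1, h2⟩ := h
    set m₁ := m'.filter fun v => v.1 = k
    set m₂ := m'.filter fun v => ¬ v.1 = k
    have h12 : m₁ + m₂ = m' := Finsupp.filter_add_filter_not _ _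
    have hm₁ : ∀ v ∈ m₁.support, v.1 = k := fun v hv => by
      rw [Finsupp.support_filter, mem_filter] at hv
      exact hv.2
    have hm₂ : ∀ v ∈ m₂.support, v.1 ∈ K := fun v hv => by
      rw [Finsupp.support_filter, mem_filter] at hv
      exact (mem_insert.1 (h1 v hv.1)).resolve_left hv.2
    obtain ⟨-, h3, h4⟩ := hsum m₁ m₂ hm₁ hm₂
    rw [h12] at h3 h4
    rw [sum_eq_single (r • m₁, r • m₂)]
    · rw [coeff_completePower, coeff_multiPower, if_pos, if_pos, one_mul]
      · exact ⟨m₂, rfl, hm₂, fun j hj => (h4 j hj).symm.trans (h2 j (mem_insert_of_mem hj))⟩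
      · exact ⟨m₁, rfl, hm₁, h3.symm.trans (h2 k (mem_insert_self _ _))⟩
    · intro p hp hne
      rw [coeff_completePower, coeff_multiPower]
      split_ifs with hp1 hp2
      · refine absurd ?_ hne
        obtain ⟨n₁, e1, hn₁, -⟩ := hp1
        obtain ⟨n₂, e2, hn₂, -⟩ := hp2
        rw [HasAntidiagonal.mem_antidiagonal, e1, e2, ← smul_add] at hp
        have hp := smul_left_cancel hr hp
        have e3 : m₁ = n₁ := by
          ext v
          simp only [m₁, ← hp, Finsupp.filter_apply, Finsupp.add_apply]
          split_ifs with hv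
          · have : n₂ v = 0 := by
              by_contra h0
              exact hk (hv ▸ hn₂ v (Finsupp.mem_support_iff.2 h0))
            omega
          · by_contra h0
            exact hv (hn₁ v (Finsupp.mem_support_iff.2 (Ne.symm h0)))
        have e4 : m₂ = n₂ := by
          rw [← e3, ← h12] at hp
          exact (add_left_cancel hp).symm
        rw [e3, e4, ← e1, ← e2]
      all_goals simp
    · intro h0
      refine absurd ?_ h0
      rw [HasAntidiagonal.mem_antidiagonal, ← smul_add, h12]
  · symm
    refine sum_eq_zero fun p hp => ?_
    rw [coeff_completePower, coeff_multiPower]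
    split_ifs with hp1 hp2
    · refine absurd ?_ h
      obtain ⟨n₁, e1, hn₁, hd⟩ := hp1
      obtain ⟨n₂, e2, hn₂, hc⟩ := hp2
      obtain ⟨h1, h3, h4⟩ := hsum n₁ n₂ hn₁ hn₂
      rw [HasAntidiagonal.mem_antidiagonal, e1, e2, ← smul_add] at hp
      refine ⟨n₁ + n₂, hp.symm, h1, fun j hj => ?_⟩
      rcases mem_insert.1 hj with rfl | hj
      · exact h3.trans hd
      · exact (h4 j hj).trans (hc j hj)
    all_goals simp

theorem prod_completePower (K : Finset ℕ+) {r : ℕ} (hr : 0 < r) (a : ℕ+ → ℕ) :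
    ∏ k ∈ K, completePower k r (a k) = multiPower K r a := by
  classical
  induction K using Finset.induction_on with
  | empty =>
    ext m
    rw [prod_empty, MvPowerSeries.coeff_one, coeff_multiPower]
    refine if_congr ⟨?_, ?_⟩ rfl rfl
    · rintro rfl
      exact ⟨0, by simp⟩
    · rintro ⟨m', rfl, h, -⟩
      have : m' = 0 := by
        ext v
        by_contra h0
        exact notMem_empty _ (h v (Finsupp.mem_support_iff.2 h0))
      rw [this, smul_zero]
  | insert k K hk ih => rw [prod_insert hk, ih, multiPower_insert hk hr]

/-- The stack partition formed by the degrees and exponents of the variables of a monomial. -/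
def stackOf (m : ℕ+ × ℕ →₀ ℕ) : StackPartition :=
  m.support.val.map fun v => (v.1, (m v).toPNat')

theorem coe_toPNat'_apply {m : ℕ+ × ℕ →₀ ℕ} {v : ℕ+ × ℕ} (hv : v ∈ m.support) :
    ((m v).toPNat' : ℕ) = m v := by
  rw [Nat.toPNat'_coe, if_pos (Nat.pos_of_ne_zero (Finsupp.mem_support_iff.1 hv))]

theorem size_stackOf (m : ℕ+ × ℕ →₀ ℕ) : (stackOf m).size = (degrees m).sum := by
  rw [sum_degrees, StackPartition.size, stackOf, Multiset.map_map]
  exact sum_congr rfl fun v hv => by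
    simp only [Function.comp_apply]
    rw [coe_toPNat'_apply hv]

theorem area_stackOf (m : ℕ+ × ℕ →₀ ℕ) :
    (stackOf m).area = Multiset.card (degrees m) := by
  rw [card_degrees, Finsupp.degree_apply, StackPartition.area, stackOf, Multiset.map_map]
  exact sum_congr rfl fun v hv => by
    simp only [Function.comp_apply]
    rw [coe_toPNat'_apply hv]

theorem coeff_monomialPoly (α : StackPartition) (m : ℕ+ × ℕ →₀ ℕ) :
    MvPowerSeries.coeff m (PolySeries.monomialPoly α) = if stackOf m = α then 1 else 0 := by
  change (if _ then _ else _) = _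
  refine if_congr ?_ rfl rfl
  have hinj : Function.Injective fun s : ℕ+ × ℕ+ => ((s.1 : ℕ), (s.2 : ℕ)) := by
    intro s t h
    rw [Prod.mk.injEq, PNat.coe_inj, PNat.coe_inj] at h
    exact Prod.ext h.1 h.2
  rw [← (Multiset.map_injective hinj).eq_iff, stackOf, Multiset.map_map]
  rw [Multiset.map_congr rfl fun v hv => ?_]
  simp only [Function.comp_apply]
  rw [coe_toPNat'_apply hv]

theorem coeff_signedH (d : ℕ) (m : ℕ+ × ℕ →₀ ℕ) :
    MvPowerSeries.coeff m (PolySeries.signedH d) =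
      if (degrees m).sum = d then (-1) ^ Multiset.card (degrees m) else 0 := by
  rw [PolySeries.signedH, map_sum]
  simp only [MvPowerSeries.coeff_smul, coeff_monomialPoly, mul_ite, mul_one, mul_zero]
  rw [sum_ite_eq, StackPartition.ofSize]
  refine if_congr ?_ ?_ rfl
  · rw [Set.Finite.mem_toFinset, Set.mem_ofPred_eq, size_stackOf]
  · rw [StackPartition.sign, area_stackOf]
    push_cast
    rfl

theorem coeff_signedHStack_smul (d r : ℕ+) (m : ℕ+ × ℕ →₀ ℕ) :
    MvPowerSeries.coeff ((r : ℕ) • m) (PolySeries.signedHStack d r) =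
      if (degrees m).sum = d then (-1) ^ Multiset.card (degrees m) else 0 := by
  rw [PolySeries.signedHStack, MvPowerSeries.coeff_expand_smul, coeff_signedH]

theorem coeff_signedHStack_of_forall_ne (d r : ℕ+) {m : ℕ+ × ℕ →₀ ℕ}
    (h : ∀ m', m ≠ (r : ℕ) • m') :
    MvPowerSeries.coeff m (PolySeries.signedHStack d r) = 0 := by
  rw [PolySeries.signedHStack]
  by_cases hd : ∃ v, ¬ (r : ℕ) ∣ m v
  · obtain ⟨v, hv⟩ := hd
    exact MvPowerSeries.coeff_expand_of_not_dvd _ _ _ hv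
  · push Not at hd
    refine absurd ?_ (h (m.mapRange (· / (r : ℕ)) (Nat.zero_div _)))
    ext v
    rw [Finsupp.smul_apply, Finsupp.mapRange_apply, smul_eq_mul, Nat.mul_div_cancel' (hd v)]

/-- The monomials of `H⁺_{d ^ r}` are sorted by the partition `lam ⊢ d` of the degrees of their
variables. -/
theorem signedHStack_eq_sum {d r : ℕ+} {K : Finset ℕ+} (hK : ∀ k : ℕ+, k ≤ d → k ∈ K) :
    PolySeries.signedHStack d r = ∑ lam : Nat.Partition d,
      (-1 : ℚ) ^ Multiset.card lam.parts •
        ∏ k ∈ K, completePower k r (lam.parts.count (k : ℕ)) := by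
  classical
  ext m
  simp only [fun a => prod_completePower K r.pos a, map_sum, MvPowerSeries.coeff_smul]
  by_cases hm : ∃ m', m = (r : ℕ) • m'
  · obtain ⟨m, rfl⟩ := hm
    have key : ∀ lam : Nat.Partition d, MvPowerSeries.coeff ((r : ℕ) • m)
        (multiPower K r fun k => lam.parts.count (k : ℕ)) =
          if degrees m = lam.parts then 1 else 0 := by
      intro lam
      rw [coeff_multiPower]
      have hle : ∀ i ∈ lam.parts, i ≤ d := fun i hi =>
        (Multiset.single_le_sum (fun _ _ => Nat.zero_le _) i hi).trans_eq lam.parts_sum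
      refine if_congr ⟨?_, ?_⟩ rfl rfl
      · rintro ⟨m', e, h1, h2⟩
        rw [smul_left_cancel r.pos e]
        ext i
        by_cases hi : ∃ k ∈ K, (k : ℕ) = i
        · obtain ⟨k, hk, rfl⟩ := hi
          exact h2 k hk
        · rw [Multiset.count_eq_zero_of_notMem, Multiset.count_eq_zero_of_notMem]
          · intro hp
            exact hi ⟨⟨i, lam.parts_pos hp⟩, hK _ (PNat.coe_le_coe _ _ |>.1 (hle i hp)), rfl⟩
          · intro hp
            obtain ⟨v, hv, rfl⟩ := Multiset.mem_map.1 hp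
            exact hi ⟨v.1, h1 v ((Finsupp.mem_toMultiset _ _).1 hv), rfl⟩
      · intro h
        refine ⟨m, rfl, fun v hv => hK _ (PNat.coe_le_coe _ _ |>.1 (hle _ ?_)),
          fun k _ => by rw [h]⟩
        rw [← h]
        exact mem_degrees.2 ⟨v, hv, rfl⟩
    simp only [key, mul_ite, mul_one, mul_zero]
    rw [coeff_signedHStack_smul]
    split_ifs with h
    · rw [sum_eq_single ⟨degrees m, fun hi => pos_of_mem_degrees hi, h⟩]
      · simp
      · intro lam _ hne
        exact if_neg fun e => hne (Nat.Partition.ext e.symm)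
      · simp
    · symm
      exact sum_eq_zero fun lam _ => if_neg fun e => h (by rw [e, lam.parts_sum])
  · push Not at hm
    rw [coeff_signedHStack_of_forall_ne d r hm]
    symm
    refine sum_eq_zero fun lam _ => ?_
    rw [coeff_multiPower, if_neg, mul_zero]
    rintro ⟨m', e, -⟩
    exact hm m' e

/-! ### Stack partitions as families of Young diagrams -/

theorem eq_of_rowLens_eq {μ ν : YoungDiagram} (h : μ.rowLens = ν.rowLens) : μ = ν :=
  YoungDiagram.equivListRowLens.injective (Subtype.ext h)

theorem rowLens_restrict (σ : StackPartition) (k : ℕ+) :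
    (σ.restrict k).rowLens = (σ.multiplicities k).sort (· ≥ ·) := by
  refine YoungDiagram.rowLens_ofRowLens_eq_self fun x hx => ?_
  rw [Multiset.mem_sort, StackPartition.multiplicities, Multiset.mem_map] at hx
  obtain ⟨s, -, rfl⟩ := hx
  exact s.2.pos

theorem restrict_eq_iff {σ : StackPartition} {k : ℕ+} {μ : YoungDiagram} :
    σ.restrict k = μ ↔ σ.multiplicities k = (μ.rowLens : Multiset ℕ) := by
  constructor
  · rintro rfl
    rw [rowLens_restrict, Multiset.sort_eq]
  · intro h
    refine eq_of_rowLens_eq ?_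
    rw [rowLens_restrict, h]
    refine List.Perm.eq_of_sortedGE ?_ (YoungDiagram.rowLens_sorted μ) ?_
    · exact (Multiset.pairwise_sort _ _).sortedGE
    · exact Multiset.coe_eq_coe.1 (Multiset.sort_eq _ _)

theorem count_multiplicities (σ : StackPartition) (k m : ℕ+) :
    (σ.multiplicities k).count (m : ℕ) = σ.count (k, m) := by
  rw [StackPartition.multiplicities, Multiset.count_map, Multiset.filter_filter,
    Multiset.count_eq_card_filter_eq]
  congr 1
  refine Multiset.filter_congr fun s _ => ?_
  rw [PNat.coe_inj, Prod.ext_iff]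
  exact ⟨fun h => ⟨h.2.symm, h.1⟩, fun h => ⟨h.2, h.1.symm⟩⟩

theorem restrict_injective {σ τ : StackPartition} (h : ∀ k, σ.restrict k = τ.restrict k) :
    σ = τ := by
  ext ⟨k, m⟩
  rw [← count_multiplicities, ← count_multiplicities, restrict_eq_iff.1 (h k),
    ← restrict_eq_iff.1 rfl]

theorem rowLens_bot : (⊥ : YoungDiagram).rowLens = [] := by
  rw [← List.length_eq_zero_iff, YoungDiagram.length_rowLens]
  by_contra h
  exact YoungDiagram.notMem_bot (0, 0)
    (YoungDiagram.mem_iff_lt_colLen.2 (Nat.pos_of_ne_zero h))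

theorem exists_restrict_eq {K : Finset ℕ+} (F : ℕ+ → YoungDiagram) (hF : ∀ k ∉ K, F k = ⊥) :
    ∃ τ : StackPartition, ∀ k, τ.restrict k = F k := by
  refine ⟨∑ k ∈ K, ((F k).rowLens : Multiset ℕ).map fun m => (k, m.toPNat'), fun k => ?_⟩
  rw [restrict_eq_iff]
  have hone : ∀ j : ℕ+, StackPartition.multiplicities
      (((F j).rowLens : Multiset ℕ).map fun m => (j, m.toPNat')) k =
        if j = k then ((F j).rowLens : Multiset ℕ) else 0 := by
    intro j
    have hfst : ∀ s ∈ ((F j).rowLens : Multiset ℕ).map fun m => (j, m.toPNat'), s.1 = j := by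
      intro s hs
      obtain ⟨m, -, rfl⟩ := Multiset.mem_map.1 hs
      rfl
    rw [StackPartition.multiplicities]
    split_ifs with h
    · rw [Multiset.filter_eq_self.2 fun s hs => (hfst s hs).trans h, Multiset.map_map]
      conv_rhs => rw [← Multiset.map_id ((F j).rowLens : Multiset ℕ)]
      refine Multiset.map_congr rfl fun m hm => ?_
      have := (F j).pos_of_mem_rowLens m (Multiset.mem_coe.1 hm)
      simp [Nat.toPNat'_coe, this]
    · rw [Multiset.filter_eq_nil.2 fun s hs e => h ((hfst s hs).symm.trans e)]
      rfl
  let φ : StackPartition →+ Multiset ℕ :=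
    { toFun := fun τ => τ.multiplicities k
      map_zero' := rfl
      map_add' := fun τ τ' => by simp [StackPartition.multiplicities] }
  have hadd : StackPartition.multiplicities
      (∑ j ∈ K, ((F j).rowLens : Multiset ℕ).map fun m => (j, m.toPNat')) k =
        ∑ j ∈ K, StackPartition.multiplicities
          (((F j).rowLens : Multiset ℕ).map fun m => (j, m.toPNat')) k :=
    map_sum φ _ K
  rw [hadd, sum_congr rfl fun j _ => hone j, sum_ite_eq']
  split_ifs with hk
  · rfl
  · rw [hF k hk, rowLens_bot]
    rfl

theorem schur_bot (k : ℕ+) : PolySeries.schur k ⊥ = 1 := by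
  classical
  ext m
  rw [MvPowerSeries.coeff_one]
  change ((Nat.card _ : ℕ) : ℚ) = _
  simp only [YoungDiagram.cells_bot, sum_empty]
  split_ifs with h
  · subst h
    rw [Nat.cast_eq_one, Nat.card_eq_one_iff_unique]
    refine ⟨⟨fun T T' => Subtype.ext (SemistandardYoungTableau.ext fun i j => ?_)⟩,
      ⟨.highestWeight ⊥, rfl⟩⟩
    rw [T.1.zeros (YoungDiagram.notMem_bot _), T'.1.zeros (YoungDiagram.notMem_bot _)]
  · rw [Nat.cast_eq_zero, Nat.card_eq_zero]
    exact Or.inl ⟨fun T => h T.2.symm⟩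

theorem schurTensor_eq_prod {σ : StackPartition} {K : Finset ℕ+}
    (h : ∀ k ∉ K, σ.restrict k = ⊥) :
    PolySeries.schurTensor σ = ∏ k ∈ K, PolySeries.schur k (σ.restrict k) := by
  refine finprod_eq_prod_of_mulSupport_subset _ fun k hk => ?_
  by_contra hK
  exact hk (by simp only [h k hK, schur_bot])

theorem isPolyribbon_refl (r : ℕ) (μ : YoungDiagram) : IsPolyribbon r 0 μ μ :=
  ⟨⟨fun _ => μ, rfl, rfl, fun i => i.elim0, fun i => i.elim0⟩⟩

theorem eq_of_isPolyribbon_zero {r : ℕ} {μ ν : YoungDiagram} (h : IsPolyribbon r 0 μ ν) :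
    ν = μ := by
  obtain ⟨C⟩ := h
  exact C.shape_last.symm.trans C.shape_zero

theorem polyribbonSign_self {r : ℕ} (hr : 0 < r) (μ : YoungDiagram) :
    polyribbonSign r μ μ = 1 :=
  have h := rowLen_eq_zero_of_card_le (le_refl μ.card)
  polyribbonSign_eq hr h h (.nil 0 _)

theorem restrict_eq_bot {σ : StackPartition} {k : ℕ+} (h : ∀ s ∈ σ, s.1 ≠ k) :
    σ.restrict k = ⊥ := by
  rw [restrict_eq_iff, rowLens_bot, StackPartition.multiplicities, Multiset.filter_eq_nil.2 h]
  rfl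

/-- The stack partition `τ` with `τ|ₖ = p k` for `k ∈ K` and `τ|ₖ = ∅` otherwise. -/
noncomputable def assemble {K : Finset ℕ+} (p : K → YoungDiagram) : StackPartition :=
  (exists_restrict_eq (K := K) (fun k => if h : k ∈ K then p ⟨k, h⟩ else ⊥)
    fun _ hk => dif_neg hk).choose

theorem restrict_assemble {K : Finset ℕ+} (p : K → YoungDiagram) (k : ℕ+) :
    (assemble p).restrict k = if h : k ∈ K then p ⟨k, h⟩ else ⊥ :=
  (exists_restrict_eq (K := K) (fun k => if h : k ∈ K then p ⟨k, h⟩ else ⊥)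
    fun _ hk => dif_neg hk).choose_spec k

theorem pieriSign_eq {σ τ : StackPartition} {d r : ℕ+} {lam : Nat.Partition d}
    (h : IsAssociated r lam σ τ) {K : Finset ℕ+}
    (hK : ∀ k ∉ K, σ.restrict k = ⊥ ∧ τ.restrict k = ⊥) :
    pieriSign d r σ τ = (-1) ^ Multiset.card lam.parts *
      ∏ k ∈ K, polyribbonSign r (σ.restrict k) (τ.restrict k) := by
  have h' : ∃ lam : Nat.Partition d, IsAssociated r lam σ τ := ⟨lam, h⟩
  rw [pieriSign, dif_pos h', h'.choose_spec.unique h,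
    finprod_eq_prod_of_mulSupport_subset _ (s := K)]
  intro k hk
  by_contra hkK
  refine hk ?_
  simp only [(hK k hkK).1, (hK k hkK).2, polyribbonSign_self r.pos]

end PolyPieri

open PolyPieri in
theorem mainTheorem3 (σ : StackPartition) (d r : ℕ+) :
    (pieriSet σ d r).Finite ∧
      PolySeries.schurTensor σ * PolySeries.signedHStack d r =
        ∑ᶠ τ ∈ pieriSet σ d r, (pieriSign d r σ τ : ℚ) • PolySeries.schurTensor τ := by
  classical
  -- a finite set of degrees outside of which nothing happens
  let K : Finset ℕ+ := σ.toFinset.image Prod.fst ∪ Icc 1 d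
  have hσ : ∀ k ∉ K, σ.restrict k = ⊥ := fun k hk => restrict_eq_bot fun s hs e =>
    hk (mem_union_left _ (mem_image.2 ⟨s, Multiset.mem_toFinset.2 hs, e⟩))
  have hd : ∀ k : ℕ+, k ≤ d → k ∈ K := fun k hk =>
    mem_union_right _ (mem_Icc.2 ⟨one_le, hk⟩)
  have hcount : ∀ (lam : Nat.Partition d), ∀ k ∉ K, lam.parts.count (k : ℕ) = 0 :=
    fun lam k hk => Multiset.count_eq_zero_of_notMem fun h => hk (hd k (PNat.coe_le_coe _ _ |>.1
      ((Multiset.single_le_sum (fun _ _ => Nat.zero_le _) _ h).trans_eq lam.parts_sum)))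
  -- the index set: a partition of `d` and a polyribbon for every degree in `K`
  let S : Finset (Σ _ : Nat.Partition d, K → YoungDiagram) := univ.sigma fun lam =>
    Fintype.piFinset fun k => polyribbons r (lam.parts.count (k : ℕ)) (σ.restrict k)
  have hassoc : ∀ a ∈ S, IsAssociated r a.1 σ (assemble a.2) := by
    intro a ha k
    rw [restrict_assemble]
    split_ifs with hk
    · exact mem_polyribbons.1 (Fintype.mem_piFinset.1 (mem_sigma.1 ha).2 ⟨k, hk⟩)
    · rw [hσ k hk, hcount _ k hk]
      exact isPolyribbon_refl r ⊥
  have hbij : Set.BijOn (fun a : Σ _ : Nat.Partition d, K → YoungDiagram => assemble a.2)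
      (S : Set (Σ _ : Nat.Partition d, K → YoungDiagram)) (pieriSet σ d r) := by
    refine ⟨fun a ha => ⟨a.1, hassoc a ha⟩, ?_, ?_⟩
    · rintro ⟨lam, p⟩ ha ⟨lam', p'⟩ ha' e
      simp only at e
      have h1 := hassoc _ ha
      have h2 := hassoc _ ha'
      simp only [e] at h1 h2
      obtain rfl := h1.unique h2
      congr 1
      funext k
      have h3 := restrict_assemble p k
      rw [e, restrict_assemble p' k, dif_pos k.2, dif_pos k.2] at h3
      exact h3.symm
    · rintro τ ⟨lam, h⟩
      refine ⟨⟨lam, fun k => τ.restrict k⟩, ?_, ?_⟩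
      · exact mem_sigma.2 ⟨mem_univ _, Fintype.mem_piFinset.2 fun k => mem_polyribbons.2 (h k)⟩
      · refine restrict_injective fun k => ?_
        rw [restrict_assemble]
        split_ifs with hk
        · rfl
        · have h1 := h k
          rw [hcount lam k hk, hσ k hk] at h1
          exact (eq_of_isPolyribbon_zero h1).symm
  refine ⟨hbij.image_eq ▸ S.finite_toSet.image _, ?_⟩
  rw [← finsum_mem_eq_of_bijOn (f := fun a : Σ _ : Nat.Partition d, K → YoungDiagram =>
      (pieriSign d r σ (assemble a.2) : ℚ) • PolySeries.schurTensor (assemble a.2)) _ hbij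
      fun _ _ => rfl,
    finsum_mem_coe_finset, sum_sigma, schurTensor_eq_prod hσ, signedHStack_eq_sum hd, mul_sum]
  refine sum_congr rfl fun lam _ => ?_
  rw [mul_smul_comm, ← prod_mul_distrib, prod_congr rfl fun k _ =>
      schur_mul_completePower k r.pos (lam.parts.count (k : ℕ)) (σ.restrict k),
    ← prod_coe_sort, prod_univ_sum, smul_sum]
  refine sum_congr rfl fun p hp => ?_
  have ha : (⟨lam, p⟩ : Σ _ : Nat.Partition d, K → YoungDiagram) ∈ S :=
    mem_sigma.2 ⟨mem_univ _, hp⟩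
  have hbot : ∀ k ∉ K, (assemble p).restrict k = ⊥ := fun k hk => by
    rw [restrict_assemble, dif_neg hk]
  have hp' : ∀ k : K, (assemble p).restrict k = p k := fun k => by
    rw [restrict_assemble, dif_pos k.2]
  have hsign : pieriSign d r σ (assemble p) = (-1) ^ Multiset.card lam.parts *
      ∏ k : K, polyribbonSign r (σ.restrict k) (p k) := by
    rw [pieriSign_eq (hassoc _ ha) fun k hk => ⟨hσ k hk, hbot k hk⟩, ← prod_coe_sort]
    simp only [hp']
  have htensor : PolySeries.schurTensor (assemble p) = ∏ k : K, PolySeries.schur k (p k) := by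
    rw [schurTensor_eq_prod hbot, ← prod_coe_sort]
    simp only [hp']
  change _ = (pieriSign d r σ (assemble p) : ℚ) • PolySeries.schurTensor (assemble p)
  rw [hsign, htensor, Finset.prod_smul, smul_smul]
  push_cast
  rfl
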